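/- **Setting.** Let $G$ be a finite-dimensional real Lie group (for instance compact and connected) with Lie algebra $\mathfrak g$, let $S^1=\mathbb R/2\pi\mathbb Z$, let $\Omega G$ be the group of smooth maps $S^1\to G$ whose value at $0$ is the identity, and let $\Omega\mathfrak g$ be the space of smooth maps $S^1\to\mathfrak g$ whose value at $0$ is zero. Let $\pi\colon P\to M$ be a smooth (right) principal $\Omega G$-bundle, where smoothness is understood in the sense of diffeology (so that finite-dimensional manifolds and Fréchet manifolds are included). Let $A$ be a connection on $P$, i.e. an $\Omega\mathfrak g$-valued $1$-form with $R_\gamma^*A=\mathrm{ad}(\gamma^{-1})A$ that takes the value $\xi$ on the fundamental vector field of each $\xi\in\Omega\mathfrak g$; let $F=dA+\tfrac12[A,A]$ be its curvature. Let $\Phi$ be a Higgs field, i.e. a smooth map $\Phi\colon P\to C^\infty(S^1,\mathfrak g)$ with $\Phi(p\gamma)=\mathrm{ad}(\gamma^{-1})\Phi(p)+\gamma^{-1}\partial\gamma$ for all $p\in P$, $\gamma\in\Omega G$, and put $$\nabla\Phi=d\Phi+[A,\Phi]-\frac{\partial A}{\partial\theta}.$$ The caloron transform of $P$ is $\widetilde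 P=(P\times G\times S^1)/\Omega G\to M\times S^1$, $[p,g,\theta]\mapsto(\pi(p),\theta)$, where $(p,g,\theta)\gamma=(p\gamma,\gamma(\theta)^{-1}g,\theta)$. It carries the connection form $$\widetilde A=\mathrm{ad}(g^{-1})A(\theta)+\Theta+\mathrm{ad}(g^{-1})\Phi\,d\theta,$$ considered as a form on the quotient, where $\Theta$ is the left-invariant Maurer–Cartan form of $G$; let $\widetilde F=d\widetilde A+\tfrac12[\widetilde A,\widetilde A]$. For a multilinear, symmetric, $\mathrm{ad}$-invariant function $f\colon\mathfrak g^k\to\mathbb R$, $k\ge1$, let $cw_f(\widetilde A)\in\Omega^{2k}(M\times S^1)$ be the form to which $f(\widetilde F,\dots,\widetilde F)$ descends, and define the string form by $$s_f(A,\Phi)=\int_{S^1}cw_f(\widetilde A)\in\Omega^{2k-1}(M),$$ where fibre integration is taken with $d\theta$ written last, i.e. $\int_{S^1}(\alpha+\beta\wedge d\theta)=\int_0^{2\pi}\beta\,d\theta$. **Proposition.** The form $\widetilde A$ is well defined on $\widetilde P$, the form $f(\widetilde F,\dots,\widetilde F)$ descends to $M\times S^1$, and $$\pi^*s_f(A,\Phi)=k\int_{S^1}f(\nabla\Phi,F,\dots,F)\,d\theta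 ,$$ where $F$ occurs $k-1$ times, as an equality of forms on $P$; that is, the string form is the form on $M$ to which $k\int_{S^1}f(\nabla\Phi,F,\dots,F)\,d\theta$ descends. -/

import Mathlib

open scoped Manifold ContDiff
open Diffeology Filter Topology

/-!
Smoothness of the (in general infinite dimensional) spaces `P`, `M`, `ΩG`, `(P × G × S¹) / ΩG` is
expressed through diffeologies. Finite dimensional manifolds and Fréchet manifolds, with all smooth
maps `ℝⁿ → X` as plots, form full subcategories of diffeological spaces; their differential forms
are the forms on plots considered here, and Fréchet principal bundles satisfy `IsPrincipalBundle`.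
-/

abbrev Euc (n : ℕ) : Type := EuclideanSpace ℝ (Fin n)

theorem contDiff_of_forall_apply {n k : ℕ} {F V : Type*} [NormedAddCommGroup F] [NormedSpace ℝ F]
    [NormedAddCommGroup V] [NormedSpace ℝ V] [FiniteDimensional ℝ V]
    {a : F → Euc n [⋀^Fin k]→L[ℝ] V}
    (h : ∀ v : Fin k → Euc n, ContDiff ℝ ∞ fun x => a x v) : ContDiff ℝ ∞ a := by
  let b := (EuclideanSpace.basisFun (Fin n) ℝ).toBasis
  let ev : (Euc n [⋀^Fin k]→L[ℝ] V) →ₗ[ℝ] ((Fin k → Fin n) → V) :=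
    { toFun := fun w s => w fun i => b (s i)
      map_add' := fun _ _ => rfl
      map_smul' := fun _ _ => rfl }
  have hev : LinearMap.ker ev = ⊥ := by
    rw [LinearMap.ker_eq_bot]
    intro w w' hw
    apply ContinuousAlternatingMap.toContinuousMultilinearMap_injective
    apply ContinuousMultilinearMap.toMultilinearMap_injective
    refine Module.Basis.ext_multilinear (fun _ => b) fun s => ?_
    exact congrFun hw s
  obtain ⟨g, hg⟩ := LinearMap.exists_leftInverse_of_injective ev hev
  have : a = fun x => LinearMap.toContinuousLinearMap g (ev (a x)) := by
    funext x
    exact (LinearMap.congr_fun hg (a x)).symm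
  rw [this]
  refine (ContinuousLinearMap.contDiff _).comp ?_
  exact contDiff_pi.2 fun s => h _

theorem exists_smooth_retract {n : ℕ} {u : Set (Euc n)} (hu : IsOpen u) {x : Euc n} (hx : x ∈ u) :
    ∃ r : Euc n → Euc n, ContDiff ℝ ∞ r ∧ (∀ y, r y ∈ u) ∧ ∀ᶠ y in 𝓝 x, r y = y := by
  obtain ⟨ε, hε, hεu⟩ := Metric.isOpen_iff.1 hu x hx
  let χ : ContDiffBump x := ⟨ε / 2, ε, half_pos hε, half_lt_self hε⟩
  refine ⟨fun y => x + χ y • (y - x), ?_, fun y => hεu ?_, ?_⟩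
  · exact contDiff_const.add (χ.contDiff.smul (contDiff_id.sub contDiff_const))
  · by_cases hy : y ∈ Metric.ball x ε
    · rw [Metric.mem_ball, dist_eq_norm, add_sub_cancel_left, norm_smul]
      rw [Metric.mem_ball, dist_eq_norm] at hy
      refine lt_of_le_of_lt ?_ hy
      have h1 : ‖χ y‖ ≤ 1 := by
        rw [Real.norm_of_nonneg χ.nonneg]; exact χ.le_one
      exact mul_le_of_le_one_left (norm_nonneg _) h1
    · have h0 : χ y = 0 := by
        apply χ.zero_of_le_dist
        simpa using hy
      simp [h0, hε]
  · filter_upwards [χ.eventuallyEq_one] with y hy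
    simp [hy]

theorem contDiff_parametric_integral_aux {D : Type} [NormedAddCommGroup D] [NormedSpace ℝ D]
    [FiniteDimensional ℝ D] (a b : ℝ) (m : ℕ) :
    ∀ {W : Type*} [NormedAddCommGroup W] [NormedSpace ℝ W] [CompleteSpace W]
      {φ : D → ℝ → W}, ContDiff ℝ ∞ (fun z : D × ℝ => φ z.1 z.2) →
      ContDiff ℝ m fun x => ∫ t in a..b, φ x t := by
  have key : ∀ {W : Type _} [NormedAddCommGroup W] [NormedSpace ℝ W] [CompleteSpace W]
      {φ : D → ℝ → W}, ContDiff ℝ ∞ (fun z : D × ℝ => φ z.1 z.2) → ∀ x,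
      HasFDerivAt (fun x => ∫ t in a..b, φ x t) (∫ t in a..b, fderiv ℝ (fun y => φ y t) x) x ∧
      ContDiff ℝ ∞ (fun z : D × ℝ => fderiv ℝ (fun y => φ y z.2) z.1) := by
    intro W _ _ _ φ hφ x
    have hd : ContDiff ℝ ∞ (fun z : D × ℝ => fderiv ℝ (fun y => φ y z.2) z.1) := by
      have h' : ContDiff ℝ ∞ (Function.uncurry fun (z : D × ℝ) (y : D) => φ y z.2) :=
        hφ.comp (contDiff_snd.prodMk (contDiff_snd.comp contDiff_fst))
      exact ContDiff.fderiv h' contDiff_fst (by simp)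
    refine ⟨?_, hd⟩
    have hK : IsCompact (Metric.closedBall x 1 ×ˢ Set.uIcc a b) :=
      (isCompact_closedBall x 1).prod isCompact_uIcc
    obtain ⟨C, hC⟩ := hK.exists_bound_of_continuousOn hd.continuous.continuousOn
    have hcont : ∀ y, Continuous fun t => φ y t := fun y =>
      hφ.continuous.comp (Continuous.prodMk_right y)
    refine intervalIntegral.hasFDerivAt_integral_of_dominated_of_fderiv_le
      (𝕜 := ℝ) (s := Metric.closedBall x 1) (bound := fun _ => C)
      (F' := fun y t => fderiv ℝ (fun y => φ y t) y)
      (Metric.closedBall_mem_nhds x one_pos) ?_ ?_ ?_ ?_ ?_ ?_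
    · exact Eventually.of_forall fun y => (hcont y).aestronglyMeasurable
    · exact (hcont x).intervalIntegrable _ _
    · exact (hd.continuous.comp (Continuous.prodMk_right x)).aestronglyMeasurable
    · refine Eventually.of_forall fun t ht y hy => ?_
      exact hC (y, t) ⟨hy, Set.uIoc_subset_uIcc ht⟩
    · exact intervalIntegrable_const
    · refine Eventually.of_forall fun t _ y _ => ?_
      have : Differentiable ℝ fun y => φ y t :=
        (hφ.comp (contDiff_id.prodMk contDiff_const)).differentiable (by simp)
      exact (this y).hasFDerivAt
  induction m with
  | zero =>
    intro W _ _ _ φ hφ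
    have h1 : Differentiable ℝ fun x => ∫ t in a..b, φ x t := fun x =>
      ((key hφ x).1).differentiableAt
    exact contDiff_zero.2 h1.continuous
  | succ m ih =>
    intro W _ _ _ φ hφ
    rw [Nat.cast_succ, contDiff_succ_iff_fderiv]
    refine ⟨fun x => ((key hφ x).1).differentiableAt, by simp, ?_⟩
    have : (fderiv ℝ fun x => ∫ t in a..b, φ x t)
        = fun x => ∫ t in a..b, fderiv ℝ (fun y => φ y t) x := by
      funext x
      exact ((key hφ x).1).fderiv
    rw [this]
    exact ih (φ := fun x t => fderiv ℝ (fun y => φ y t) x) (key hφ 0).2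

theorem contDiff_parametric_integral {D : Type} [NormedAddCommGroup D] [NormedSpace ℝ D]
    [FiniteDimensional ℝ D] (a b : ℝ) {W : Type*} [NormedAddCommGroup W] [NormedSpace ℝ W]
    [CompleteSpace W] {φ : D → ℝ → W} (hφ : ContDiff ℝ ∞ (fun z : D × ℝ => φ z.1 z.2)) :
    ContDiff ℝ ∞ fun x => ∫ t in a..b, φ x t :=
  contDiff_infty.2 fun m => contDiff_parametric_integral_aux a b m hφ

/-! ### Diffeologies on products, quotients, the circle and loop groups -/

instance Prod.instDiffeologicalSpace {X Y : Type*} [DiffeologicalSpace X] [DiffeologicalSpace Y] :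
    DiffeologicalSpace (X × Y) where
  plots n := {p | IsPlot (fun x => (p x).1) ∧ IsPlot (fun x => (p x).2)}
  constant_plots x := ⟨isPlot_const, isPlot_const⟩
  plot_reparam hp hf := ⟨isPlot_reparam hp.1 hf, isPlot_reparam hp.2 hf⟩
  locality {n p} hp := by
    constructor
    · refine DiffeologicalSpace.locality fun x => ?_
      obtain ⟨u, hu, hx, h⟩ := hp x
      exact ⟨u, hu, hx, fun hf hs => (h hf hs).1⟩
    · refine DiffeologicalSpace.locality fun x => ?_
      obtain ⟨u, hu, hx, h⟩ := hp x
      exact ⟨u, hu, hx, fun hf hs => (h hf hs).2⟩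

/-- The quotient diffeology along a surjection `f : X → Y`: the plots of `Y` are the maps that
lift, locally, to plots of `X`. -/
@[reducible]
def pushforwardDiffeology {X Y : Type*} [DiffeologicalSpace X] (f : X → Y)
    (hf : Function.Surjective f) : DiffeologicalSpace Y where
  plots n := {p | ∀ x, ∃ q : Euc n → X, IsPlot q ∧ ∀ᶠ y in 𝓝 x, f (q y) = p y}
  constant_plots y _ := by
    obtain ⟨x, rfl⟩ := hf y
    exact ⟨fun _ => x, isPlot_const, Eventually.of_forall fun _ => rfl⟩
  plot_reparam {n m p h} hp hh x := by
    obtain ⟨q, hq, hqp⟩ := hp (h x)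
    exact ⟨q ∘ h, isPlot_reparam hq hh, hh.continuous.continuousAt.eventually hqp⟩
  locality {n p} hp x := by
    obtain ⟨u, hu, hx, h⟩ := hp x
    obtain ⟨r, hr, hru, hrx⟩ := exists_smooth_retract hu hx
    obtain ⟨q, hq, hqp⟩ := h hru hr x
    refine ⟨q, hq, ?_⟩
    filter_upwards [hqp, hrx] with y h1 h2
    rw [h1, Function.comp_apply, h2]

/-- The circle `S¹ = ℝ / 2πℤ` (`Real.Angle`) with its quotient diffeology. -/
noncomputable instance Real.Angle.instDiffeologicalSpace : DiffeologicalSpace Real.Angle :=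
  pushforwardDiffeology (fun t : ℝ => (t : Real.Angle)) Quotient.mk_surjective

/-- The diffeology of the manifold `G` is the one whose plots are the smooth maps `ℝⁿ → G`. -/
class IsContMDiffCompatible (E G : Type*) [NormedAddCommGroup E] [NormedSpace ℝ E]
    [TopologicalSpace G] [ChartedSpace E G] [DiffeologicalSpace G] : Prop where
  isPlot_iff_contMDiff : ∀ {n : ℕ} {p : Euc n → G},
    IsPlot p ↔ ContMDiff 𝓘(ℝ, Euc n) 𝓘(ℝ, E) ∞ p

/-- The diffeology of a manifold `G`. -/
@[reducible]
def manifoldDiffeology (E G : Type*) [NormedAddCommGroup E] [NormedSpace ℝ E]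
    [TopologicalSpace G] [ChartedSpace E G] : DiffeologicalSpace G where
  plots n := {p | ContMDiff 𝓘(ℝ, Euc n) 𝓘(ℝ, E) ∞ p}
  constant_plots _ := contMDiff_const
  plot_reparam hp hh := ContMDiff.comp hp hh.contMDiff
  locality {n p} hp x := by
    obtain ⟨u, hu, hx, h⟩ := hp x
    obtain ⟨r, hr, hru, hrx⟩ := exists_smooth_retract hu hx
    refine ContMDiffAt.congr_of_eventuallyEq ((h hru hr) x) ?_
    filter_upwards [hrx] with y hy
    simp [hy]

theorem isContMDiffCompatible_manifoldDiffeology (E G : Type*) [NormedAddCommGroup E]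
    [NormedSpace ℝ E] [TopologicalSpace G] [ChartedSpace E G] :
    @IsContMDiffCompatible E G _ _ _ _ (manifoldDiffeology E G) :=
  letI := manifoldDiffeology E G
  ⟨Iff.rfl⟩

section LieGroups

variable (E G : Type*) [NormedAddCommGroup E] [NormedSpace ℝ E]
  [TopologicalSpace G] [ChartedSpace E G] [Group G] [LieGroup 𝓘(ℝ, E) ∞ G]

/-- The based loop group `ΩG`: smooth maps `S¹ → G` whose value at `0` is `1`, under pointwise
multiplication. -/
def loopSubgroup : Subgroup (Real.Angle → G) where
  carrier := {γ | ContMDiff 𝓘(ℝ, ℝ) 𝓘(ℝ, E) ∞ (fun t : ℝ => γ t) ∧ γ 0 = 1}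
  one_mem' := ⟨contMDiff_const, rfl⟩
  mul_mem' ha hb := ⟨ha.1.mul hb.1, by simp [ha.2, hb.2]⟩
  inv_mem' ha := ⟨ha.1.inv, by simp [ha.2]⟩

abbrev LoopGroup : Type _ := loopSubgroup E G

/-- The diffeology of `ΩG`: a family of loops is smooth if it is jointly smooth in the parameter
and the angle. -/
instance LoopGroup.instDiffeologicalSpace : DiffeologicalSpace (LoopGroup E G) where
  plots n := {c | ContMDiff 𝓘(ℝ, Euc n × ℝ) 𝓘(ℝ, E) ∞
    (fun y : Euc n × ℝ => (c y.1).1 (y.2 : Real.Angle))}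
  constant_plots γ := γ.2.1.comp (contDiff_snd.contMDiff)
  plot_reparam {n m p h} hp hh :=
    ContMDiff.comp hp
      ((hh.comp contDiff_fst).prodMk contDiff_snd : ContDiff ℝ ∞
        fun y : Euc n × ℝ => (h y.1, y.2)).contMDiff
  locality {n p} hp := by
    rintro ⟨x, t⟩
    obtain ⟨u, hu, hx, h⟩ := hp x
    obtain ⟨r, hr, hru, hrx⟩ := exists_smooth_retract hu hx
    have h1 := (h hru hr) (x, t)
    refine ContMDiffAt.congr_of_eventuallyEq h1 ?_
    have : ∀ᶠ y : Euc n × ℝ in 𝓝 (x, t), r y.1 = y.1 :=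
      (continuous_fst.tendsto (x, t)).eventually hrx
    filter_upwards [this] with y hy
    simp [hy]

end LieGroups

section LieAlgebra

variable (E G : Type*) [NormedAddCommGroup E] [NormedSpace ℝ E]
  [TopologicalSpace G] [ChartedSpace E G] [Group G]

/-- The Lie bracket of the Lie algebra `𝔤 = T₁G`. In Mathlib the tangent space `T₁G` is by
definition the model space `E`; throughout we write `E` for it, as `E` carries the norm. -/
noncomputable def lieBr (v w : E) : E :=
  Bracket.bracket (L := GroupLieAlgebra 𝓘(ℝ, E) G) (M := GroupLieAlgebra 𝓘(ℝ, E) G) v w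

variable {E G} in
/-- The adjoint action of `G` on `𝔤 = T₁G`: the derivative at `1` of `h ↦ g h g⁻¹`. -/
noncomputable def Ad (g : G) : E →L[ℝ] E :=
  (mfderiv 𝓘(ℝ, E) 𝓘(ℝ, E) (fun h : G => g * h * g⁻¹) (1 : G) :)

variable [FiniteDimensional ℝ E] [LieGroup 𝓘(ℝ, E) ∞ G]

/-- The Lie bracket as a (continuous) bilinear map. -/
noncomputable def lieBrMultilinear : ContinuousMultilinearMap ℝ (fun _ : Fin 2 => E) E :=
  haveI : LieGroup 𝓘(ℝ, E) (minSmoothness ℝ 3) G := by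
    rw [minSmoothness_of_isRCLikeNormedField]; infer_instance
  let B : E →ₗ[ℝ] E →ₗ[ℝ] E := LinearMap.mk₂ ℝ (lieBr E G)
    (fun a b c => add_lie (L := GroupLieAlgebra 𝓘(ℝ, E) G) (M := GroupLieAlgebra 𝓘(ℝ, E) G) a b c)
    (fun t a b => smul_lie (L := GroupLieAlgebra 𝓘(ℝ, E) G) (M := GroupLieAlgebra 𝓘(ℝ, E) G) t a b)
    (fun a b c => lie_add (L := GroupLieAlgebra 𝓘(ℝ, E) G) (M := GroupLieAlgebra 𝓘(ℝ, E) G) a b c)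
    (fun t a b => lie_smul (L := GroupLieAlgebra 𝓘(ℝ, E) G) (M := GroupLieAlgebra 𝓘(ℝ, E) G) t a b)
  let B' : E →L[ℝ] E →L[ℝ] E :=
    LinearMap.toContinuousLinearMap
      ((LinearMap.toContinuousLinearMap : (E →ₗ[ℝ] E) ≃ₗ[ℝ] (E →L[ℝ] E)).toLinearMap ∘ₗ B)
  B'.uncurryBilinear.compContinuousLinearMap
    fun _ => (ContinuousLinearMap.id ℝ E).prod (ContinuousLinearMap.id ℝ E)

theorem lieBrMultilinear_apply (v : Fin 2 → E) :
    lieBrMultilinear E G v = lieBr E G (v 0) (v 1) := rfl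

end LieAlgebra

/-! ### Differential forms on diffeological spaces -/

/-- A smooth differential `k`-form on `X` with values in `V`: a smooth `k`-form on `ℝⁿ` for every
plot `ℝⁿ → X`, compatibly with pullback along smooth reparametrisations. -/
structure DForm (X : Type*) [DiffeologicalSpace X] (k : ℕ) (V : Type*) [NormedAddCommGroup V]
    [NormedSpace ℝ V] where
  /-- the pullback of the form along a plot `p` -/
  onPlot : ∀ {n : ℕ} (p : Euc n → X), IsPlot p → Euc n → Euc n [⋀^Fin k]→L[ℝ] V
  smooth : ∀ {n : ℕ} (p : Euc n → X) (hp : IsPlot p), ContDiff ℝ ∞ (onPlot p hp)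
  reparam : ∀ {m n : ℕ} (p : Euc n → X) (hp : IsPlot p) (h : Euc m → Euc n)
    (hh : ContDiff ℝ ∞ h) (x : Euc m),
    onPlot (p ∘ h) (isPlot_reparam hp hh) x =
      (onPlot p hp (h x)).compContinuousLinearMap (fderiv ℝ h x)

namespace DForm

variable {X Y : Type*} [DiffeologicalSpace X] [DiffeologicalSpace Y] {k l : ℕ}
  {V W : Type*} [NormedAddCommGroup V] [NormedSpace ℝ V] [NormedAddCommGroup W] [NormedSpace ℝ W]

theorem congr_plot (a : DForm X k V) {n : ℕ} {p q : Euc n → X} (h : p = q) (hp : IsPlot p)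
    (hq : IsPlot q) : a.onPlot p hp = a.onPlot q hq := by
  subst h; rfl

@[ext]
theorem ext {a b : DForm X k V}
    (h : ∀ {n : ℕ} (p : Euc n → X) (hp : IsPlot p) (x : Euc n), a.onPlot p hp x = b.onPlot p hp x) :
    a = b := by
  cases a; cases b
  congr
  funext n p hp x
  exact h p hp x

instance : Zero (DForm X k V) where
  zero :=
    { onPlot := fun _ _ _ => 0
      smooth := fun _ _ => contDiff_const
      reparam := fun _ _ _ _ _ => rfl }

instance : Add (DForm X k V) where
  add a b :=
    { onPlot := fun p hp x => a.onPlot p hp x + b.onPlot p hp x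
      smooth := fun p hp => (a.smooth p hp).add (b.smooth p hp)
      reparam := fun p hp h hh x => by rw [a.reparam p hp h hh, b.reparam p hp h hh]; rfl }

instance : SMul ℝ (DForm X k V) where
  smul c a :=
    { onPlot := fun p hp x => c • a.onPlot p hp x
      smooth := fun p hp => (a.smooth p hp).const_smul c
      reparam := fun p hp h hh x => by rw [a.reparam p hp h hh]; rfl }

/-- Pullback of a form along a smooth map. -/
def pullback (φ : X → Y) (hφ : DSmooth φ) (a : DForm Y k V) : DForm X k V where
  onPlot p hp := a.onPlot (φ ∘ p) (hp.dSmooth_comp hφ)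
  smooth _ _ := a.smooth _ _
  reparam p hp h hh x := a.reparam (φ ∘ p) (hp.dSmooth_comp hφ) h hh x

/-- A smooth function, as a `0`-form. -/
noncomputable def ofFun (φ : X → V)
    (hφ : ∀ {n : ℕ} (p : Euc n → X), IsPlot p → ContDiff ℝ ∞ (φ ∘ p)) : DForm X 0 V where
  onPlot {n} p _ x := ContinuousAlternatingMap.constOfIsEmpty ℝ (Euc n) (Fin 0) (φ (p x))
  smooth {n} p hp :=
    (ContinuousAlternatingMap.constOfIsEmptyLIE ℝ (Euc n) V (Fin 0)).contDiff.comp (hφ p hp)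
  reparam p hp h hh x := by ext v; simp

/-- The exterior derivative. -/
noncomputable def d (a : DForm X k V) : DForm X (k + 1) V where
  onPlot p hp := extDeriv (a.onPlot p hp)
  smooth {n} p hp :=
    (ContinuousAlternatingMap.alternatizeUncurryFinCLM ℝ (Euc n) V).contDiff.comp
      ((a.smooth p hp).fderiv_right (by simp))
  reparam p hp h hh x := by
    have : a.onPlot (p ∘ h) (isPlot_reparam hp hh) =
        fun x => (a.onPlot p hp (h x)).compContinuousLinearMap (fderiv ℝ h x) :=
      funext fun x => a.reparam p hp h hh x
    rw [this]
    exact extDeriv_pullback (r := ∞) ((a.smooth p hp).differentiable (by simp) _) hh.contDiffAt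
      (by rw [minSmoothness_of_isRCLikeNormedField]; exact WithTop.coe_le_coe.2 le_top)

end DForm

section Wedge

variable {D D' V W : Type*} [NormedAddCommGroup D] [NormedSpace ℝ D] [NormedAddCommGroup D']
  [NormedSpace ℝ D'] [NormedAddCommGroup V] [NormedSpace ℝ V] [NormedAddCommGroup W]
  [NormedSpace ℝ W] {m N : ℕ}

theorem plugIn_update (q : Fin m → ℕ) (a : ∀ i, D [⋀^Fin (q i)]→L[ℝ] V)
    [DecidableEq ((i : Fin m) × Fin (q i))] (v : (i : Fin m) × Fin (q i) → D)
    (s : (i : Fin m) × Fin (q i)) (x : D) :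
    (fun i => a i fun j => Function.update v s x ⟨i, j⟩) =
      Function.update (fun i => a i fun j => v ⟨i, j⟩) s.1
        (a s.1 (Function.update (fun j => v ⟨s.1, j⟩) s.2 x)) := by
  obtain ⟨i₀, j₀⟩ := s
  funext i
  by_cases hi : i = i₀
  · subst hi
    rw [Function.update_self]
    congr 1
    funext j
    by_cases hj : j = j₀
    · subst hj; simp
    · rw [Function.update_of_ne (by simpa using hj), Function.update_of_ne hj]
  · rw [Function.update_of_ne hi]
    congr 1
    funext j
    rw [Function.update_of_ne (fun h => hi (congrArg Sigma.fst h))]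

/-- The multilinear map `v ↦ f (α₁(v₁₁, …, v₁q₁), …, αₘ(vₘ₁, …, vₘqₘ))`. -/
def plugIn (f : ContinuousMultilinearMap ℝ (fun _ : Fin m => V) W) (q : Fin m → ℕ)
    (a : ∀ i, D [⋀^Fin (q i)]→L[ℝ] V) :
    ContinuousMultilinearMap ℝ (fun _ : (i : Fin m) × Fin (q i) => D) W where
  toFun v := f fun i => a i fun j => v ⟨i, j⟩
  map_update_add' v s x y := by
    simp only [plugIn_update, ContinuousAlternatingMap.map_update_add,
      ContinuousMultilinearMap.map_update_add]
  map_update_smul' v s c x := by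
    simp only [plugIn_update, ContinuousAlternatingMap.map_update_smul,
      ContinuousMultilinearMap.map_update_smul]
  cont := by fun_prop

/-- The value `f(α₁ ∧ … ∧ αₘ)` of a multilinear map `f` on alternating maps `αᵢ` of degrees `qᵢ`:
`(v₁, …, v_N) ↦ (q₁! ⋯ qₘ!)⁻¹ ∑_σ sign σ • f (α₁(v_{σ 1}, …), …, αₘ(…, v_{σ N}))`,
so that `f(ξ₁ ω₁, …, ξₘ ωₘ) = f(ξ₁, …, ξₘ) ω₁ ∧ … ∧ ωₘ` for the wedge product with
`(ω ∧ η)(v, w) = ω(v) η(w) - ω(w) η(v)` on `1`-forms. -/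
noncomputable def wedgeAlt (f : ContinuousMultilinearMap ℝ (fun _ : Fin m => V) W) (q : Fin m → ℕ)
    (hq : ∑ i, q i = N) (a : ∀ i, D [⋀^Fin (q i)]→L[ℝ] V) : D [⋀^Fin N]→L[ℝ] W :=
  ((∏ i, (q i).factorial : ℕ) : ℝ)⁻¹ • ContinuousMultilinearMap.alternatization
    ((plugIn f q a).domDomCongr (finSigmaFinEquiv.trans (finCongr hq)))

theorem wedgeAlt_apply (f : ContinuousMultilinearMap ℝ (fun _ : Fin m => V) W) (q : Fin m → ℕ)
    (hq : ∑ i, q i = N) (a : ∀ i, D [⋀^Fin (q i)]→L[ℝ] V) (v : Fin N → D) :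
    wedgeAlt f q hq a v = ((∏ i, (q i).factorial : ℕ) : ℝ)⁻¹ • ∑ σ : Equiv.Perm (Fin N),
      Equiv.Perm.sign σ • f fun i => a i fun j => v (σ (finCongr hq (finSigmaFinEquiv ⟨i, j⟩))) := by
  simp only [wedgeAlt, ContinuousAlternatingMap.smul_apply,
    ContinuousMultilinearMap.alternatization_apply_apply]
  rfl

end Wedge

theorem wedgeAlt_compCLM {D D' V W : Type*} [NormedAddCommGroup D] [NormedSpace ℝ D]
    [NormedAddCommGroup D'] [NormedSpace ℝ D'] [NormedAddCommGroup V] [NormedSpace ℝ V]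
    [NormedAddCommGroup W] [NormedSpace ℝ W] {m N : ℕ}
    (f : ContinuousMultilinearMap ℝ (fun _ : Fin m => V) W) (q : Fin m → ℕ)
    (hq : ∑ i, q i = N) (a : ∀ i, D [⋀^Fin (q i)]→L[ℝ] V) (L : D' →L[ℝ] D) :
    (wedgeAlt f q hq fun i => (a i).compContinuousLinearMap L) =
      (wedgeAlt f q hq a).compContinuousLinearMap L := by
  ext v
  simp only [wedgeAlt_apply, ContinuousAlternatingMap.compContinuousLinearMap_apply]
  rfl

namespace DForm

variable {X : Type*} [DiffeologicalSpace X] {V W : Type*} [NormedAddCommGroup V]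
  [NormedSpace ℝ V] [NormedAddCommGroup W] [NormedSpace ℝ W] [FiniteDimensional ℝ W] {m N : ℕ}

/-- The form `f(α₁, …, αₘ)` obtained by wedging `V`-valued forms `αᵢ` of degrees `qᵢ` and
applying the multilinear map `f` to their values. -/
noncomputable def wedge (f : ContinuousMultilinearMap ℝ (fun _ : Fin m => V) W) (q : Fin m → ℕ)
    (hq : ∑ i, q i = N) (a : ∀ i, DForm X (q i) V) : DForm X N W where
  onPlot p hp x := wedgeAlt f q hq fun i => (a i).onPlot p hp x
  smooth {n} p hp := by
    refine contDiff_of_forall_apply fun v => ?_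
    simp only [wedgeAlt_apply]
    refine ContDiff.const_smul _ (ContDiff.sum fun σ _ => ContDiff.const_smul _ ?_)
    refine f.contDiff.comp (contDiff_pi.2 fun i => ?_)
    exact (ContinuousAlternatingMap.apply ℝ (Euc n) V _).contDiff.comp ((a i).smooth p hp)
  reparam p hp h hh x := by
    simp only [fun i => (a i).reparam p hp h hh x]
    exact wedgeAlt_compCLM f q hq _ _

/-- `f(α, β, …, β)` for a form `α` of degree `p` and a form `β` of degree `2`. -/
noncomputable def wedgeCons {k p : ℕ} (f : ContinuousMultilinearMap ℝ (fun _ : Fin (k + 1) => V) W)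
    (a : DForm X p V) (b : DForm X 2 V) (hN : p + 2 * k = N) : DForm X N W :=
  wedge f (Fin.cons p fun _ => 2) (by simp [Fin.sum_univ_succ]; omega)
    (Fin.cons (α := fun i => DForm X ((Fin.cons p fun _ => 2 : Fin (k + 1) → ℕ) i) V) a fun _ => b)

/-- `[α ∧ β]` for `V`-valued forms `α`, `β` and a bilinear map `[·, ·]`. -/
noncomputable def wedge₂ {p q : ℕ} (f : ContinuousMultilinearMap ℝ (fun _ : Fin 2 => V) W)
    (a : DForm X p V) (b : DForm X q V) : DForm X (p + q) W :=
  wedge f (Fin.cons p fun _ => q) (by simp [Fin.sum_univ_succ])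
    (Fin.cons (α := fun i => DForm X ((Fin.cons p fun _ => q : Fin 2 → ℕ) i) V) a fun _ => b)

end DForm

/-! ### Integration over the circle -/

section FibreIntegral

/-- The inclusion `ℝⁿ → ℝⁿ⁺¹`, `x ↦ (x, 0)`. -/
noncomputable def inclEuc (n : ℕ) : Euc n →L[ℝ] Euc (n + 1) :=
  LinearMap.toContinuousLinearMap
    { toFun := fun x => WithLp.toLp 2 (Fin.snoc (α := fun _ => ℝ) (fun i => x i) 0)
      map_add' := fun x y => by
        ext i; refine Fin.lastCases ?_ (fun i => ?_) i <;> simp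
      map_smul' := fun c x => by
        ext i; refine Fin.lastCases ?_ (fun i => ?_) i <;> simp }

/-- The projection `ℝⁿ⁺¹ → ℝⁿ`, `(x, t) ↦ x`. -/
noncomputable def initEuc (n : ℕ) : Euc (n + 1) →L[ℝ] Euc n :=
  LinearMap.toContinuousLinearMap
    { toFun := fun y => WithLp.toLp 2 (fun i => y i.castSucc)
      map_add' := fun x y => by ext i; simp
      map_smul' := fun c x => by ext i; simp }

/-- The last basis vector `∂/∂t` of `ℝⁿ⁺¹`. -/
noncomputable def lastEuc (n : ℕ) : Euc (n + 1) := EuclideanSpace.single (Fin.last n) 1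

/-- The last coordinate `ℝⁿ⁺¹ → ℝ`, `(x, t) ↦ t`. -/
noncomputable def lastCoord (n : ℕ) : Euc (n + 1) →L[ℝ] ℝ := EuclideanSpace.proj (Fin.last n)

theorem initEuc_incl_add (n : ℕ) (x : Euc n) (t : ℝ) :
    initEuc n (inclEuc n x + t • lastEuc n) = x := by
  ext i
  simp [initEuc, inclEuc, lastEuc]

theorem lastCoord_incl_add (n : ℕ) (x : Euc n) (t : ℝ) :
    lastCoord n (inclEuc n x + t • lastEuc n) = t := by
  simp [lastCoord, inclEuc, lastEuc]

variable {M : Type*} [DiffeologicalSpace M] {k : ℕ} {V : Type*} [NormedAddCommGroup V]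
  [NormedSpace ℝ V]

/-- The plot `(x, t) ↦ (p(x), [t])` of `M × S¹`. -/
noncomputable def cylinder {n : ℕ} (p : Euc n → M) : Euc (n + 1) → M × Real.Angle :=
  fun y => (p (initEuc n y), (lastCoord n y : Real.Angle))

theorem isPlot_cylinder {n : ℕ} {p : Euc n → M} (hp : IsPlot p) : IsPlot (cylinder p) := by
  refine ⟨isPlot_reparam hp (initEuc n).contDiff, fun x => ⟨fun y => lastCoord n y, ?_, ?_⟩⟩
  · exact (lastCoord n).contDiff.isPlot
  · exact Eventually.of_forall fun _ => rfl

/-- The contraction of an alternating map with `e` in the last slot: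
`(v₁, …, v_k) ↦ ω(v₁, …, v_k, e)`. -/
noncomputable def insertLast {D : Type*} [NormedAddCommGroup D] [NormedSpace ℝ D]
    (a : D [⋀^Fin (k + 1)]→L[ℝ] V) (e : D) : D [⋀^Fin k]→L[ℝ] V :=
  { (ContinuousLinearMap.apply ℝ V e).compContinuousMultilinearMap
      a.toContinuousMultilinearMap.curryRight with
    map_eq_zero_of_eq' := fun v i j hv hij =>
      a.map_eq_zero_of_eq (Fin.snoc (α := fun _ => D) v e) (i := i.castSucc) (j := j.castSucc)
        (by simpa using hv) (by simpa using hij) }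

theorem insertLast_apply {D : Type*} [NormedAddCommGroup D] [NormedSpace ℝ D]
    (a : D [⋀^Fin (k + 1)]→L[ℝ] V) (e : D) (v : Fin k → D) :
    insertLast a e v = a (Fin.snoc (α := fun _ => D) v e) := rfl

/-- The integrand of fibre integration: at `(x, t)`, the form
`(v₁, …, v_k) ↦ ω(v₁, …, v_k, ∂/∂t)`. -/
noncomputable def fibreIntegrand (a : DForm (M × Real.Angle) (k + 1) V) {n : ℕ} (p : Euc n → M)
    (hp : IsPlot p) (x : Euc n) (t : ℝ) : Euc n [⋀^Fin k]→L[ℝ] V :=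
  (insertLast (a.onPlot (cylinder p) (isPlot_cylinder hp) (inclEuc n x + t • lastEuc n))
    (lastEuc n)).compContinuousLinearMap (inclEuc n)

theorem fibreIntegrand_reparam (a : DForm (M × Real.Angle) (k + 1) V) {m n : ℕ} (p : Euc n → M)
    (hp : IsPlot p) (h : Euc m → Euc n) (hh : ContDiff ℝ ∞ h) (x : Euc m) (t : ℝ) :
    fibreIntegrand a (p ∘ h) (isPlot_reparam hp hh) x t =
      (fibreIntegrand a p hp (h x) t).compContinuousLinearMap (fderiv ℝ h x) := by
  let h' : Euc (m + 1) → Euc (n + 1) :=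
    fun y => inclEuc n (h (initEuc m y)) + lastCoord m y • lastEuc n
  have hh' : ContDiff ℝ ∞ h' :=
    ((inclEuc n).contDiff.comp (hh.comp (initEuc m).contDiff)).add
      ((lastCoord m).contDiff.smul contDiff_const)
  have hc : cylinder (p ∘ h) = cylinder p ∘ h' := by
    funext y
    simp only [cylinder, Function.comp_apply, h', initEuc_incl_add, lastCoord_incl_add]
  have hx : h' (inclEuc m x + t • lastEuc m) = inclEuc n (h x) + t • lastEuc n := by
    simp only [h', initEuc_incl_add, lastCoord_incl_add]
  have hd : HasFDerivAt h' ((inclEuc n).comp ((fderiv ℝ h x).comp (initEuc m)) +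
      (lastCoord m).smulRight (lastEuc n)) (inclEuc m x + t • lastEuc m) := by
    have e0 : HasFDerivAt h (fderiv ℝ h x) (initEuc m (inclEuc m x + t • lastEuc m)) := by
      rw [initEuc_incl_add]
      exact (hh.differentiable (by simp) x).hasFDerivAt
    have e1 := HasFDerivAt.comp _ e0 (initEuc m).hasFDerivAt
    exact ((inclEuc n).hasFDerivAt.comp _ e1).add
      ((lastCoord m).hasFDerivAt.smul_const (lastEuc n))
  have j1 : ∀ v : Euc m, initEuc m (inclEuc m v) = v := fun v => by
    simpa using initEuc_incl_add m v 0
  have j2 : ∀ v : Euc m, lastCoord m (inclEuc m v) = 0 := fun v => by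
    simpa using lastCoord_incl_add m v 0
  have j3 : initEuc m (lastEuc m) = 0 := by simpa using initEuc_incl_add m 0 1
  have j4 : lastCoord m (lastEuc m) = 1 := by simpa using lastCoord_incl_add m 0 1
  have e := a.reparam (cylinder p) (isPlot_cylinder hp) h' hh' (inclEuc m x + t • lastEuc m)
  rw [hx, hd.fderiv] at e
  ext v
  rw [fibreIntegrand, a.congr_plot hc (isPlot_cylinder (isPlot_reparam hp hh))
    (isPlot_reparam (isPlot_cylinder hp) hh'), e]
  simp only [fibreIntegrand, ContinuousAlternatingMap.compContinuousLinearMap_apply,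
    insertLast_apply]
  refine congrArg _ (funext fun i => ?_)
  refine Fin.lastCases ?_ (fun i => ?_) i
  · simp [j3, j4]
  · simp [j1, j2]

theorem integral_compCLM {D D' W : Type*} [NormedAddCommGroup D] [NormedSpace ℝ D]
    [NormedAddCommGroup D'] [NormedSpace ℝ D'] [NormedAddCommGroup W] [NormedSpace ℝ W]
    [CompleteSpace W] {φ : D → ℝ → D [⋀^Fin k]→L[ℝ] W}
    (hφ' : ContDiff ℝ ∞ fun z : D × ℝ => φ z.1 z.2) (x : D) (L : D' →L[ℝ] D) (s t : ℝ) :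
    (∫ r in s..t, (φ x r).compContinuousLinearMap L) =
      (∫ r in s..t, φ x r).compContinuousLinearMap L := by
  have hφ : Continuous (φ x) := hφ'.continuous.comp (Continuous.prodMk_right x)
  have hi : IntervalIntegrable (φ x) MeasureTheory.volume s t := hφ.intervalIntegrable _ _
  have hi' : IntervalIntegrable (fun r => (φ x r).compContinuousLinearMap L)
      MeasureTheory.volume s t :=
    ((ContinuousAlternatingMap.compContinuousLinearMapCLM (F := W) (ι := Fin k)
      L).continuous.comp hφ).intervalIntegrable _ _
  ext v
  rw [ContinuousAlternatingMap.compContinuousLinearMap_apply]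
  have e1 := ContinuousLinearMap.intervalIntegral_comp_comm
    (ContinuousAlternatingMap.apply ℝ D' W v) hi'
  have e2 := ContinuousLinearMap.intervalIntegral_comp_comm
    (ContinuousAlternatingMap.apply ℝ D W (L ∘ v)) hi
  exact e1.symm.trans e2

variable [FiniteDimensional ℝ V]

theorem contDiff_fibreIntegrand (a : DForm (M × Real.Angle) (k + 1) V) {n : ℕ} (p : Euc n → M)
    (hp : IsPlot p) : ContDiff ℝ ∞ fun z : Euc n × ℝ => fibreIntegrand a p hp z.1 z.2 := by
  refine contDiff_of_forall_apply fun v => ?_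
  refine (ContinuousAlternatingMap.apply ℝ (Euc (n + 1)) V
    (Fin.snoc (α := fun _ => Euc (n + 1)) (fun i => inclEuc n (v i)) (lastEuc n))).contDiff.comp ?_
  refine (a.smooth _ _).comp ?_
  exact ((inclEuc n).contDiff.comp contDiff_fst).add (contDiff_snd.smul contDiff_const)

/-- Integration over the fibre `S¹` of a form on `M × S¹`, with `dθ` written last:
`∫_{S¹} (α + β ∧ dθ) = ∫₀^{2π} β dθ`. -/
noncomputable def fibreIntegral (a : DForm (M × Real.Angle) (k + 1) V) : DForm M k V where
  onPlot p hp x := ∫ t in (0 : ℝ)..(2 * Real.pi), fibreIntegrand a p hp x t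
  smooth p hp := contDiff_parametric_integral _ _ (contDiff_fibreIntegrand a p hp)
  reparam {m n} p hp h hh x := by
    simp only [fibreIntegrand_reparam a p hp h hh x]
    exact integral_compCLM (contDiff_fibreIntegrand a p hp) (h x) (fderiv ℝ h x) _ _

end FibreIntegral

/-! ### Principal bundles, connections, Higgs fields -/

/-- `π : P → M` is a (smooth, right) principal `Γ`-bundle, `p · γ` being `MulOpposite.op γ • p`: the
projection and the action are smooth, `Γ` acts freely along the fibres, `π` has smooth local
sections over (every plot of) `M`, and two smooth families of points in the same fibres differ by a
smooth family of elements of `Γ`. So pulling `P` back along a plot of `M` gives a bundle that is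
locally equivariantly isomorphic to a product with `Γ`. -/
structure IsPrincipalBundle (Γ : Type*) [Group Γ] [DiffeologicalSpace Γ] {P M : Type*}
    [DiffeologicalSpace P] [DiffeologicalSpace M] [MulAction Γᵐᵒᵖ P] (π : P → M) : Prop where
  smooth_proj : DSmooth π
  smooth_action : DSmooth fun x : P × Γ => MulOpposite.op x.2 • x.1
  proj_smul : ∀ (γ : Γ) (p : P), π (MulOpposite.op γ • p) = π p
  free : ∀ (γ : Γ) (p : P), MulOpposite.op γ • p = p → γ = 1
  exists_lift : ∀ {n : ℕ} (r : Euc n → M), IsPlot r → ∀ x,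
    ∃ q : Euc n → P, IsPlot q ∧ ∀ᶠ y in 𝓝 x, π (q y) = r y
  exists_div : ∀ {n : ℕ} (p q : Euc n → P), IsPlot p → IsPlot q → (∀ x, π (p x) = π (q x)) →
    ∃ c : Euc n → Γ, IsPlot c ∧ ∀ x, q x = MulOpposite.op (c x) • p x

section Caloron

variable {E G : Type*} [NormedAddCommGroup E] [NormedSpace ℝ E]
  [TopologicalSpace G] [ChartedSpace E G] [Group G] [LieGroup 𝓘(ℝ, E) ∞ G]

/-- The `𝔤`-valued `1`-form `g⁻¹ dg` of a map `g : D → G`, i.e. the pullback along `g` of the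
left invariant Maurer-Cartan form of `G`. -/
noncomputable def maurerCartan {D : Type*} [NormedAddCommGroup D] [NormedSpace ℝ D] (g : D → G)
    (x : D) : D →L[ℝ] E :=
  (mfderiv 𝓘(ℝ, D) 𝓘(ℝ, E) (fun y => (g x)⁻¹ * g y) x :)

/-- The derivative `γ⁻¹ ∂γ : S¹ → 𝔤` of a loop. -/
noncomputable def loopLogDeriv (γ : LoopGroup E G) (θ : Real.Angle) : E :=
  maurerCartan (fun t : ℝ => γ.1 (θ + (t : Real.Angle))) 0 1

/-- The pullback of the form `dθ` of `S¹` along a map into `S¹`. -/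
noncomputable def dTheta {D : Type*} [NormedAddCommGroup D] [NormedSpace ℝ D] (c : D → Real.Angle)
    (x : D) : D →L[ℝ] ℝ :=
  fderiv ℝ (fun y => (c y - c x).toReal) x

/-- Smoothness of a family `(αθ)` of `V`-valued forms, `θ ∈ S¹`. Such a family is the same thing as
a form with values in the space of smooth maps `S¹ → V`. -/
def SmoothLoopOfForms {X : Type*} [DiffeologicalSpace X] {k : ℕ} {V : Type*} [NormedAddCommGroup V]
    [NormedSpace ℝ V] (a : Real.Angle → DForm X k V) : Prop :=
  ∀ (n : ℕ) (p : Euc n → X) (hp : IsPlot p),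
    ContDiff ℝ ∞ fun y : Euc n × ℝ => (a (y.2 : Real.Angle)).onPlot p hp y.1

theorem contDiff_partialDeriv {D W : Type*} [NormedAddCommGroup D] [NormedSpace ℝ D]
    [NormedAddCommGroup W] [NormedSpace ℝ W] {φ : D → ℝ → W}
    (hφ : ContDiff ℝ ∞ fun z : D × ℝ => φ z.1 z.2) (s : ℝ) :
    ContDiff ℝ ∞ fun x => deriv (fun t => φ x (s + t)) 0 := by
  have h : ContDiff ℝ ∞ (Function.uncurry fun (x : D) (t : ℝ) => φ x (s + t)) :=
    hφ.comp (contDiff_fst.prodMk (contDiff_const.add contDiff_snd))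
  exact (ContDiff.fderiv (g := fun _ => (0 : ℝ)) h contDiff_const (by simp)).clm_apply
    (contDiff_const (c := (1 : ℝ)))

theorem deriv_compCLM {D D' W : Type*} [NormedAddCommGroup D] [NormedSpace ℝ D]
    [NormedAddCommGroup D'] [NormedSpace ℝ D'] [NormedAddCommGroup W] [NormedSpace ℝ W] {k : ℕ}
    {φ : D → ℝ → D [⋀^Fin k]→L[ℝ] W} (hφ : ContDiff ℝ ∞ fun z : D × ℝ => φ z.1 z.2) (x : D)
    (L : D' →L[ℝ] D) (s : ℝ) :
    deriv (fun t => (φ x (s + t)).compContinuousLinearMap L) 0 =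
      (deriv (fun t => φ x (s + t)) 0).compContinuousLinearMap L := by
  have h : ContDiff ℝ ∞ fun t => φ x (s + t) :=
    hφ.comp (contDiff_const.prodMk (contDiff_const.add contDiff_id))
  have hd : HasDerivAt (fun t => φ x (s + t)) (deriv (fun t => φ x (s + t)) 0) 0 :=
    (h.differentiable (by simp) 0).hasDerivAt
  exact ((ContinuousAlternatingMap.compContinuousLinearMapCLM (F := W) (ι := Fin k)
    L).hasFDerivAt.comp_hasDerivAt 0 hd).deriv

/-- The derivative `∂α/∂θ` of a smooth loop of forms. -/
noncomputable def angleDeriv {X : Type*} [DiffeologicalSpace X] {k : ℕ} {V : Type*}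
    [NormedAddCommGroup V] [NormedSpace ℝ V] (a : Real.Angle → DForm X k V)
    (ha : SmoothLoopOfForms a) (θ : Real.Angle) : DForm X k V where
  onPlot p hp x := deriv (fun t : ℝ => (a (θ + (t : Real.Angle))).onPlot p hp x) 0
  smooth {n} p hp := by
    obtain ⟨s, rfl⟩ : ∃ s : ℝ, (s : Real.Angle) = θ := Quotient.mk_surjective θ
    simp only [← Real.Angle.coe_add]
    exact contDiff_partialDeriv (φ := fun x t => (a (t : Real.Angle)).onPlot p hp x) (ha _ p hp) s
  reparam p hp h hh x := by
    obtain ⟨s, rfl⟩ : ∃ s : ℝ, (s : Real.Angle) = θ := Quotient.mk_surjective θ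
    simp only [← Real.Angle.coe_add, fun t => (a t).reparam p hp h hh x]
    exact deriv_compCLM (φ := fun x t => (a (t : Real.Angle)).onPlot p hp x) (ha _ p hp) (h x)
      (fderiv ℝ h x) s

/-- The integral `∫_{S¹} α(θ) dθ = ∫₀^{2π} α(θ) dθ` of a smooth loop of forms. -/
noncomputable def loopIntegral {X : Type*} [DiffeologicalSpace X] {k : ℕ} {V : Type*}
    [NormedAddCommGroup V] [NormedSpace ℝ V] [CompleteSpace V] (a : Real.Angle → DForm X k V)
    (ha : SmoothLoopOfForms a) : DForm X k V where
  onPlot p hp x := ∫ θ in (0 : ℝ)..(2 * Real.pi), (a (θ : Real.Angle)).onPlot p hp x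
  smooth p hp := contDiff_parametric_integral _ _ (ha _ p hp)
  reparam p hp h hh x := by
    simp only [fun t => (a t).reparam p hp h hh x]
    exact integral_compCLM (φ := fun x t => (a (t : Real.Angle)).onPlot p hp x) (ha _ p hp) (h x)
      (fderiv ℝ h x) _ _

variable {P M : Type*} [DiffeologicalSpace P] [DiffeologicalSpace M]
  [MulAction (LoopGroup E G)ᵐᵒᵖ P] {π : P → M}

/-- The map `p ↦ p · γ` on a principal bundle is smooth. -/
theorem IsPrincipalBundle.dSmooth_smul {Γ : Type*} [Group Γ] [DiffeologicalSpace Γ] {P M : Type*}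
    [DiffeologicalSpace P] [DiffeologicalSpace M] [MulAction Γᵐᵒᵖ P] {π : P → M}
    (hπ : IsPrincipalBundle Γ π) (γ : Γ) : DSmooth fun p : P => MulOpposite.op γ • p :=
  fun n p hp => hπ.smooth_action n (fun x => (p x, γ)) ⟨hp, isPlot_const⟩

/-- The map `γ ↦ p · γ` on a principal bundle is smooth. -/
theorem IsPrincipalBundle.dSmooth_orbit {Γ : Type*} [Group Γ] [DiffeologicalSpace Γ] {P M : Type*}
    [DiffeologicalSpace P] [DiffeologicalSpace M] [MulAction Γᵐᵒᵖ P] {π : P → M}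
    (hπ : IsPrincipalBundle Γ π) (p : P) : DSmooth fun γ : Γ => MulOpposite.op γ • p :=
  fun n c hc => hπ.smooth_action n (fun x => (p, c x)) ⟨isPlot_const, hc⟩

/-- A connection on an `ΩG`-bundle: an `Ω𝔤`-valued `1`-form `A` on `P`, i.e. a smooth loop of
`𝔤`-valued `1`-forms `A(θ)` with `A(0) = 0`, that is equivariant under the right action and takes
the value `ξ` on the fundamental vector field of `ξ ∈ Ω𝔤`. -/
structure LoopConnection (hπ : IsPrincipalBundle (LoopGroup E G) π) where
  form : Real.Angle → DForm P 1 E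
  smooth : SmoothLoopOfForms form
  based : form 0 = 0
  /-- `R_γ^* A = ad(γ⁻¹) A` -/
  equivariant : ∀ (γ : LoopGroup E G) (θ : Real.Angle) {n : ℕ} (p : Euc n → P) (hp : IsPlot p)
    (x v : Euc n), ((form θ).pullback _ (hπ.dSmooth_smul γ)).onPlot p hp x (fun _ => v) =
      Ad (γ.1 θ)⁻¹ ((form θ).onPlot p hp x (fun _ => v))
  /-- on the velocity of `p · c` at the point `p`, where `c` is a smooth family in `ΩG` through `1`,
  the form `A` takes as its value the velocity of `c` at `1` -/
  vertical : ∀ (p : P) (θ : Real.Angle) {n : ℕ} (c : Euc n → LoopGroup E G) (hc : IsPlot c),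
    c 0 = 1 → ∀ v : Euc n,
      ((form θ).pullback _ (hπ.dSmooth_orbit p)).onPlot c hc 0 (fun _ => v) =
        maurerCartan (fun x => (c x).1 θ) 0 v

/-- A Higgs field on an `ΩG`-bundle: a smooth map `Φ` from `P` to the space of smooth maps
`S¹ → 𝔤` with `Φ(p γ) = ad(γ⁻¹) Φ(p) + γ⁻¹ ∂γ`. (The loops `Φ(p)` are not required to vanish at
the base point, since `γ⁻¹ ∂γ` need not vanish there.) -/
structure HiggsField (hπ : IsPrincipalBundle (LoopGroup E G) π) where
  toFun : P → Real.Angle → E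
  smooth : ∀ {n : ℕ} (p : Euc n → P), IsPlot p →
    ContDiff ℝ ∞ fun y : Euc n × ℝ => toFun (p y.1) (y.2 : Real.Angle)
  equivariant : ∀ (p : P) (γ : LoopGroup E G) (θ : Real.Angle),
    toFun (MulOpposite.op γ • p) θ = Ad (γ.1 θ)⁻¹ (toFun p θ) + loopLogDeriv γ θ

/-- The function `p ↦ Φ(p)(θ)`, as a `0`-form. -/
noncomputable def HiggsField.atAngle {hπ : IsPrincipalBundle (LoopGroup E G) π} (Φ : HiggsField hπ)
    (θ : Real.Angle) : DForm P 0 E :=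
  DForm.ofFun (fun p => Φ.toFun p θ) fun {n} p hp => by
    obtain ⟨s, rfl⟩ : ∃ s : ℝ, (s : Real.Angle) = θ := Quotient.mk_surjective θ
    exact (Φ.smooth p hp).comp (contDiff_id.prodMk contDiff_const : ContDiff ℝ ∞
      fun x : Euc n => (x, s))

variable (G) in
/-- The curvature `dA + ½ [A, A]` of a `𝔤`-valued `1`-form. -/
noncomputable def curvature [FiniteDimensional ℝ E] {X : Type*} [DiffeologicalSpace X] (A : DForm X 1 E) :
    DForm X 2 E :=
  A.d + (1 / 2 : ℝ) • DForm.wedge₂ (lieBrMultilinear E G) A A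

/-- The covariant derivative `∇Φ = dΦ + [A, Φ] - ∂A/∂θ` of a Higgs field, at the angle `θ`. -/
noncomputable def nablaHiggs [FiniteDimensional ℝ E] {hπ : IsPrincipalBundle (LoopGroup E G) π}
    (A : LoopConnection hπ) (Φ : HiggsField hπ) (θ : Real.Angle) : DForm P 1 E :=
  (Φ.atAngle θ).d + DForm.wedge₂ (lieBrMultilinear E G) (A.form θ) (Φ.atAngle θ) +
    (-1 : ℝ) • angleDeriv A.form A.smooth θ

/-- The loop of forms `f(∇Φ, F, …, F)` on `P`, where `F` is the curvature of `A`. -/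
noncomputable def higgsCurvatureForm [FiniteDimensional ℝ E]
    {hπ : IsPrincipalBundle (LoopGroup E G) π} {k : ℕ}
    (f : ContinuousMultilinearMap ℝ (fun _ : Fin (k + 1) => E) ℝ) (A : LoopConnection hπ)
    (Φ : HiggsField hπ) (θ : Real.Angle) : DForm P (2 * k + 1) ℝ :=
  DForm.wedgeCons f (nablaHiggs A Φ θ) (curvature G (A.form θ)) (Nat.add_comm 1 (2 * k))

/-- The elements of `I^k(𝔤)`: multilinear, symmetric, `ad`-invariant functions of degree `k`. -/
structure InvariantPolynomial (E G : Type*) [NormedAddCommGroup E] [NormedSpace ℝ E]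
    [TopologicalSpace G] [ChartedSpace E G] [Group G] (k : ℕ) where
  toMultilinear : ContinuousMultilinearMap ℝ (fun _ : Fin k => E) ℝ
  symmetric : ∀ (σ : Equiv.Perm (Fin k)) (v : Fin k → E),
    toMultilinear (fun i => v (σ i)) = toMultilinear v
  invariant : ∀ (g : G) (v : Fin k → E), toMultilinear (fun i => Ad g (v i)) = toMultilinear v

open Classical in
/-- The form on `Y` to which a form `a` on `X` descends along `φ : X → Y`, i.e. the form whose
pullback to `X` is `a` (and `0` if there is none). -/
noncomputable def DForm.descend {X Y : Type*} [DiffeologicalSpace X] [DiffeologicalSpace Y] {k : ℕ}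
    {V : Type*} [NormedAddCommGroup V] [NormedSpace ℝ V] (φ : X → Y) (hφ : DSmooth φ)
    (a : DForm X k V) : DForm Y k V :=
  if h : ∃ b : DForm Y k V, b.pullback φ hφ = a then h.choose else 0

/-! ### The caloron transform -/

variable (E G P) in
/-- `(p, g, θ) ∼ (p γ, γ(θ)⁻¹ g, θ)` for `γ ∈ ΩG`. -/
def caloronSetoid : Setoid (P × G × Real.Angle) where
  r x y := ∃ γ : LoopGroup E G, y = (MulOpposite.op γ • x.1, (γ.1 x.2.2)⁻¹ * x.2.1, x.2.2)
  iseqv :=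
    { refl := fun x => ⟨1, by simp⟩
      symm := by
        rintro ⟨p, g, θ⟩ _ ⟨γ, rfl⟩
        refine ⟨γ⁻¹, ?_⟩
        simp
      trans := by
        rintro ⟨p, g, θ⟩ _ _ ⟨γ, rfl⟩ ⟨δ, rfl⟩
        refine ⟨γ * δ, ?_⟩
        simp [mul_smul, mul_assoc] }

variable (E G P) in
/-- The caloron transform `(P × G × S¹) / ΩG` of an `ΩG`-bundle `P`. -/
def CaloronTransform : Type _ := Quotient (caloronSetoid E G P)

variable (E G P) in
/-- The quotient map `(p, g, θ) ↦ [p, g, θ]`. -/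
def caloronMk (x : P × G × Real.Angle) : CaloronTransform E G P :=
  Quotient.mk (caloronSetoid E G P) x

variable [DiffeologicalSpace G]

noncomputable instance CaloronTransform.instDiffeologicalSpace :
    DiffeologicalSpace (CaloronTransform E G P) :=
  pushforwardDiffeology (caloronMk E G P) Quotient.mk_surjective

theorem dSmooth_caloronMk : DSmooth (caloronMk E G P) :=
  fun _ p hp _ => ⟨p, hp, Eventually.of_forall fun _ => rfl⟩

/-- The projection `[p, g, θ] ↦ (π(p), θ)` of the `G`-bundle `(P × G × S¹) / ΩG → M × S¹`. -/
def caloronProj (hπ : IsPrincipalBundle (LoopGroup E G) π) :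
    CaloronTransform E G P → M × Real.Angle :=
  Quotient.lift (s := caloronSetoid E G P) (fun x => (π x.1, x.2.2)) (by
    rintro x _ ⟨γ, rfl⟩
    simp [hπ.proj_smul])

theorem dSmooth_caloronProj (hπ : IsPrincipalBundle (LoopGroup E G) π) :
    DSmooth (caloronProj hπ) := by
  intro n p hp
  refine DiffeologicalSpace.locality fun x => ?_
  obtain ⟨q, hq, hqp⟩ := hp x
  obtain ⟨u, hux, hu, hxu⟩ := eventually_nhds_iff.1 hqp
  refine ⟨u, hu, hxu, fun {m f} hf hfs => ?_⟩
  have : (caloronProj hπ ∘ p) ∘ f = fun y => (π (q (f y)).1, (q (f y)).2.2) := by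
    funext y
    simp only [Function.comp_apply, ← hux _ (hf y)]
    rfl
  rw [this]
  exact ⟨(isPlot_reparam hq.1 hfs).dSmooth_comp hπ.smooth_proj, isPlot_reparam hq.2.2 hfs⟩

/-- `Ã` is the connection form `ad(g⁻¹) A(θ) + Θ + ad(g⁻¹) Φ dθ`, considered as a form on the
quotient `(P × G × S¹) / ΩG`. -/
def IsCaloronConnection {hπ : IsPrincipalBundle (LoopGroup E G) π} (A : LoopConnection hπ)
    (Φ : HiggsField hπ) (At : DForm (CaloronTransform E G P) 1 E) : Prop :=
  ∀ (n : ℕ) (p : Euc n → P) (g : Euc n → G) (c : Euc n → Real.Angle) (hp : IsPlot p)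
    (hg : IsPlot g) (hc : IsPlot c) (x v : Euc n),
    (At.pullback (caloronMk E G P) dSmooth_caloronMk).onPlot (fun y => (p y, g y, c y))
        ⟨hp, hg, hc⟩ x (fun _ => v) =
      Ad (g x)⁻¹ ((A.form (c x)).onPlot p hp x (fun _ => v)) + maurerCartan g x v +
        dTheta c x v • Ad (g x)⁻¹ (Φ.toFun (p x) (c x))

open Classical in
/-- The connection `Ã` on the caloron transform (defined as `0` if there is no such form). -/
noncomputable def caloronConnection {hπ : IsPrincipalBundle (LoopGroup E G) π}
    (A : LoopConnection hπ) (Φ : HiggsField hπ) : DForm (CaloronTransform E G P) 1 E :=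
  if h : ∃ At, IsCaloronConnection A Φ At then h.choose else 0

/-- The form `f(F, …, F)` of degree `2k`. -/
noncomputable def polyCurvature {X : Type*} [DiffeologicalSpace X] {k : ℕ}
    (f : InvariantPolynomial E G k) (F : DForm X 2 E) : DForm X (2 * k) ℝ :=
  DForm.wedge f.toMultilinear (fun _ => 2) (by simp [mul_comm]) fun _ => F

/-- The Chern-Weil form `cw_f(Ã)` on `M × S¹`: the form to which `f(F̃, …, F̃)` descends, where
`F̃` is the curvature of the caloron connection. -/
noncomputable def caloronChernWeil [FiniteDimensional ℝ E]
    {hπ : IsPrincipalBundle (LoopGroup E G) π} {k : ℕ}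
    (f : InvariantPolynomial E G k) (A : LoopConnection hπ) (Φ : HiggsField hπ) :
    DForm (M × Real.Angle) (2 * k) ℝ :=
  (polyCurvature f (curvature G (caloronConnection A Φ))).descend (caloronProj hπ)
    (dSmooth_caloronProj hπ)

/-- The string form `s_f(A, Φ) = ∫_{S¹} cw_f(Ã)`, of degree `2(k + 1) - 1 = 2k + 1`, of an invariant
polynomial `f` of degree `k + 1`. -/
noncomputable def stringForm [FiniteDimensional ℝ E]
    {hπ : IsPrincipalBundle (LoopGroup E G) π} {k : ℕ}
    (f : InvariantPolynomial E G (k + 1)) (A : LoopConnection hπ) (Φ : HiggsField hπ) :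
    DForm M (2 * k + 1) ℝ :=
  fibreIntegral (caloronChernWeil f A Φ)

end Caloron

/-! Pull everything back to `P × G × S¹`. There the caloron connection is the gauge transform by `g`
of the form `H = A(θ) + Φ dθ` on `P × S¹` (`higgsConnection`). Under a family of loops `γ`,
evaluated at the moving angle, `H` becomes `Ad(γ⁻¹) H + γ⁻¹dγ` (`higgsConnection_smul`): the
inhomogeneous term of `A` supplies the derivative of `γ` at fixed angle, and that of `Φ` supplies
the derivative in the angle. Replacing `g` by `γ(θ)⁻¹ g` cancels this change, so the connection
descends to the quotient (`exists_isCaloronConnection`).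

Curvature transforms by `Ad(g⁻¹)` (`linCurvature_gauge`, from the Maurer-Cartan equation
`fderiv_maurerCartan`). By invariance, `f(F̃, …, F̃)` is therefore `f` of the curvature of `H` and
does not see `g`. Two plots of `P × G × S¹` over the same plot of `M × S¹` differ by a gauge family
and a change of `g`, so the form descends to `M × S¹` (`exists_caloronProj_pullback_eq`).

The curvature of `H` is `F + ∇Φ ∧ dθ` (`linCurvature_cylinder`). By symmetry of `f`, contracting
`f(F + ∇Φ ∧ dθ, …)` with `∂/∂θ` in the last slot gives the degree of `f` times `f(∇Φ, F, …, F)`.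
With the alternating sum over all permutations this is a count of the positions that can receive
`∂/∂θ` (`sum_pairTerm`, `sum_pairTerm_snoc`). The formula thus holds at each angle, before
integration (`fibreIntegrand_caloronChernWeil`). The degree of `f` is written `k + 1` there. -/

/-! ### Maurer-Cartan forms and the adjoint action, computed in the chart at the identity. -/

section LieGroupCalculus

variable {E G : Type*} [NormedAddCommGroup E] [NormedSpace ℝ E]
  [TopologicalSpace G] [ChartedSpace E G] [Group G] [LieGroup 𝓘(ℝ, E) ∞ G]
  {D D' : Type*} [NormedAddCommGroup D] [NormedSpace ℝ D]
  [NormedAddCommGroup D'] [NormedSpace ℝ D']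

variable (E G) in
/-- The chart of a Lie group at the identity. -/
noncomputable def oneChart : PartialEquiv G E := extChartAt 𝓘(ℝ, E) (1 : G)

-- Every velocity is first translated to the identity, so a single chart suffices. The hypothesis `g
-- x = 1` makes the preferred chart at `g x` this one.
omit [LieGroup 𝓘(ℝ, E) ∞ G] in
theorem mfderiv_eq_fderiv_oneChart {g : D → G} {x : D}
    (hg : ContMDiffAt 𝓘(ℝ, D) 𝓘(ℝ, E) ∞ g x) (h1 : g x = 1) :
    (mfderiv 𝓘(ℝ, D) 𝓘(ℝ, E) g x : D →L[ℝ] E) = fderiv ℝ (fun y => oneChart E G (g y)) x := by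
  refine (if_pos (hg.mdifferentiableAt (by simp))).trans ?_
  simp [writtenInExtChartAt, h1, oneChart, Function.comp_def]
  rfl

omit [LieGroup 𝓘(ℝ, E) ∞ G] in
theorem contDiffAt_oneChart_comp {g : D → G} {x : D}
    (hg : ContMDiffAt 𝓘(ℝ, D) 𝓘(ℝ, E) ∞ g x) (h1 : g x = 1) :
    ContDiffAt ℝ ∞ (fun y => oneChart E G (g y)) x := by
  have : ContMDiffAt 𝓘(ℝ, E) 𝓘(ℝ, E) ∞ (oneChart E G) (g x) := by
    rw [h1]; exact contMDiffAt_extChartAt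
  exact (this.comp x hg).contDiffAt

omit [LieGroup 𝓘(ℝ, E) ∞ G] in
theorem oneChart_symm_apply_one : (oneChart E G).symm (oneChart E G 1) = 1 :=
  extChartAt_to_inv (I := 𝓘(ℝ, E)) (1 : G)

omit [LieGroup 𝓘(ℝ, E) ∞ G] in
theorem oneChart_target_mem_nhds : (oneChart E G).target ∈ 𝓝 (oneChart E G 1) :=
  extChartAt_target_mem_nhds (I := 𝓘(ℝ, E)) (1 : G)

theorem contMDiffAt_oneChart_symm :
    ContMDiffAt 𝓘(ℝ, E) 𝓘(ℝ, E) ∞ (oneChart E G).symm (oneChart E G 1) :=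
  (contMDiffOn_extChartAt_symm (I := 𝓘(ℝ, E)) (n := ∞) (1 : G)).contMDiffAt
    oneChart_target_mem_nhds

theorem maurerCartan_eq_fderiv {g : D → G} {x : D}
    (hg : ContMDiffAt 𝓘(ℝ, D) 𝓘(ℝ, E) ∞ g x) :
    maurerCartan g x = fderiv ℝ (fun y => oneChart E G ((g x)⁻¹ * g y)) x :=
  mfderiv_eq_fderiv_oneChart (contMDiffAt_const.mul hg) (by simp)

theorem hasFDerivAt_maurerCartan {g : D → G} {x : D}
    (hg : ContMDiffAt 𝓘(ℝ, D) 𝓘(ℝ, E) ∞ g x) :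
    HasFDerivAt (fun y => oneChart E G ((g x)⁻¹ * g y)) (maurerCartan g x) x := by
  rw [maurerCartan_eq_fderiv hg]
  exact ((contDiffAt_oneChart_comp (contMDiffAt_const.mul hg) (by simp)).differentiableAt
    (by simp)).hasFDerivAt

theorem contMDiff_conj (g : G) :
    ContMDiff 𝓘(ℝ, E) 𝓘(ℝ, E) ∞ fun h : G => g * h * g⁻¹ :=
  (contMDiff_const.mul contMDiff_id).mul contMDiff_const

theorem hasFDerivAt_Ad (g : G) :
    HasFDerivAt (fun z => oneChart E G (g * (oneChart E G).symm z * g⁻¹)) (Ad g : E →L[ℝ] E)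
      (oneChart E G 1) := by
  have h0 : ContMDiffAt 𝓘(ℝ, E) 𝓘(ℝ, E) ∞ (fun z => g * (oneChart E G).symm z * g⁻¹)
      (oneChart E G 1) := (contMDiffAt_const.mul contMDiffAt_oneChart_symm).mul contMDiffAt_const
  have h1 : (Ad g : E →L[ℝ] E) =
      fderiv ℝ (fun z => oneChart E G (g * (oneChart E G).symm z * g⁻¹)) (oneChart E G 1) := by
    refine (if_pos ((contMDiff_conj g).mdifferentiableAt (by simp))).trans ?_
    simp [writtenInExtChartAt, oneChart, Function.comp_def]
  rw [h1]
  exact ((contDiffAt_oneChart_comp h0 (by simp [oneChart_symm_apply_one])).differentiableAt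
    (by simp)).hasFDerivAt

omit [LieGroup 𝓘(ℝ, E) ∞ G] in
theorem eventually_oneChart_symm_apply : ∀ᶠ a in 𝓝 (1 : G),
    (oneChart E G).symm (oneChart E G a) = a := by
  filter_upwards [extChartAt_source_mem_nhds (I := 𝓘(ℝ, E)) (1 : G)] with a ha
  exact (oneChart E G).left_inv ha

omit [LieGroup 𝓘(ℝ, E) ∞ G] in
theorem eventually_oneChart_apply_symm : ∀ᶠ z in 𝓝 (oneChart E G 1),
    oneChart E G ((oneChart E G).symm z) = z := by
  filter_upwards [oneChart_target_mem_nhds] with a ha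
  exact (oneChart E G).right_inv ha

/-- Conjugation acts on velocities at the identity through the adjoint action. -/
theorem HasFDerivAt.oneChart_conj {k : D → G} {x : D} {L : D →L[ℝ] E}
    (hk : HasFDerivAt (fun y => oneChart E G (k y)) L x) (hc : ContinuousAt k x) (h1 : k x = 1)
    (g : G) :
    HasFDerivAt (fun y => oneChart E G (g * k y * g⁻¹)) ((Ad g : E →L[ℝ] E).comp L) x := by
  have h := (hasFDerivAt_Ad (E := E) g)
  rw [← h1] at h
  refine (h.comp x hk).congr_of_eventuallyEq ?_
  have : Tendsto k (𝓝 x) (𝓝 1) := by rw [← h1]; exact hc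
  filter_upwards [this.eventually (eventually_oneChart_symm_apply (E := E))] with y hy
  simp [hy]

/-- The derivative of a product of two maps through the identity is the sum of the derivatives. -/
theorem HasFDerivAt.oneChart_mul {a b : D → G} {x : D} {L K : D →L[ℝ] E}
    (ha : ContMDiffAt 𝓘(ℝ, D) 𝓘(ℝ, E) ∞ a x) (hb : ContMDiffAt 𝓘(ℝ, D) 𝓘(ℝ, E) ∞ b x)
    (a1 : a x = 1) (b1 : b x = 1)
    (hL : HasFDerivAt (fun y => oneChart E G (a y)) L x)
    (hK : HasFDerivAt (fun y => oneChart E G (b y)) K x) :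
    HasFDerivAt (fun y => oneChart E G (a y * b y)) (L + K) x := by
  -- The two factors get independent variables. The derivative `T` of this map is linear, so its
  -- value on the diagonal is the sum of its values on the two axes, where one factor is frozen at
  -- the identity.
  have hF : DifferentiableAt ℝ (fun z : D × D => oneChart E G (a z.1 * b z.2)) (x, x) := by
    refine (contDiffAt_oneChart_comp (x := (x, x)) ?_ (by simp [a1, b1])).differentiableAt (by simp)
    exact (ContMDiffAt.comp (x, x) (g := a) (f := Prod.fst) ha contDiffAt_fst.contMDiffAt).mul
      (ContMDiffAt.comp (x, x) (g := b) (f := Prod.snd) hb contDiffAt_snd.contMDiffAt)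
  obtain ⟨T, hT⟩ := hF
  have hd := hT.comp (f := fun y => (y, y)) x
    ((hasFDerivAt_id (𝕜 := ℝ) x).prodMk (hasFDerivAt_id (𝕜 := ℝ) x))
  have h1 := hT.comp (f := fun y => (y, x)) x
    ((hasFDerivAt_id (𝕜 := ℝ) x).prodMk (hasFDerivAt_const (𝕜 := ℝ) x x))
  have h2 := hT.comp (f := fun y => (x, y)) x
    ((hasFDerivAt_const (𝕜 := ℝ) x x).prodMk (hasFDerivAt_id (𝕜 := ℝ) x))
  simp only [Function.comp_def, a1, b1, mul_one, one_mul] at hd h1 h2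
  have e1 := h1.unique hL
  have e2 := h2.unique hK
  rw [← e1, ← e2]
  convert hd using 1
  ext v
  simp [← map_add]

/-- The translated product `(g x h x)⁻¹ g y h y` equals `h x⁻¹ (g x⁻¹ g y) h x` times `h x⁻¹ h y`: a
conjugate times a second map, both through the identity at `x`. -/
theorem maurerCartan_mul {g h : D → G} {x : D} (hg : ContMDiffAt 𝓘(ℝ, D) 𝓘(ℝ, E) ∞ g x)
    (hh : ContMDiffAt 𝓘(ℝ, D) 𝓘(ℝ, E) ∞ h x) :
    maurerCartan (fun y => g y * h y) x =
      (Ad (h x)⁻¹ : E →L[ℝ] E).comp (maurerCartan g x) + maurerCartan h x := by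
  have cg : ContMDiffAt 𝓘(ℝ, D) 𝓘(ℝ, E) ∞ (fun y => (g x)⁻¹ * g y) x := contMDiffAt_const.mul hg
  have ch : ContMDiffAt 𝓘(ℝ, D) 𝓘(ℝ, E) ∞ (fun y => (h x)⁻¹ * h y) x := contMDiffAt_const.mul hh
  have k1 := (hasFDerivAt_maurerCartan hg).oneChart_conj cg.continuousAt (by simp) (h x)⁻¹
  have k := k1.oneChart_mul ((contMDiffAt_const.mul cg).mul contMDiffAt_const) ch (by simp)
    (by simp) (hasFDerivAt_maurerCartan hh)
  refine (hasFDerivAt_maurerCartan (hg.mul hh)).unique (k.congr_of_eventuallyEq ?_)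
  refine Eventually.of_forall fun y => ?_
  simp [mul_assoc]

theorem maurerCartan_comp {g : D → G} {h : D' → D} {x : D'}
    (hg : ContMDiffAt 𝓘(ℝ, D) 𝓘(ℝ, E) ∞ g (h x)) (hh : ContDiffAt ℝ ∞ h x) :
    maurerCartan (fun y => g (h y)) x = (maurerCartan g (h x) : D →L[ℝ] E).comp (fderiv ℝ h x) := by
  have h1 := (hasFDerivAt_maurerCartan hg).comp x
    (hh.differentiableAt (by simp)).hasFDerivAt
  exact (hasFDerivAt_maurerCartan (hg.comp x hh.contMDiffAt)).unique h1

theorem maurerCartan_const (g : G) (x : D) :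
    (maurerCartan (fun _ => g) x : D →L[ℝ] E) = 0 := by
  rw [maurerCartan_eq_fderiv contMDiffAt_const]
  simp

omit [LieGroup 𝓘(ℝ, E) ∞ G] in
theorem maurerCartan_const_mul (g : G) {h : D → G} {x : D} :
    (maurerCartan (fun y => g * h y) x : D →L[ℝ] E) = maurerCartan h x := by
  have : (fun y => (g * h x)⁻¹ * (g * h y)) = fun y => (h x)⁻¹ * h y := by
    funext y; group
  exact congrArg (β := D →L[ℝ] E) (fun F : D → G => (mfderiv 𝓘(ℝ, D) 𝓘(ℝ, E) F x :)) this

theorem Ad_mul (g h : G) : (Ad (g * h) : E →L[ℝ] E) = (Ad g).comp (Ad h) := by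
  have hs := contMDiffAt_oneChart_symm (E := E) (G := G)
  have h1 := (hasFDerivAt_Ad (E := E) h).oneChart_conj
    (k := fun z => h * (oneChart E G).symm z * h⁻¹)
    ((contMDiffAt_const.mul hs).mul contMDiffAt_const).continuousAt
    (by simp [oneChart_symm_apply_one]) g
  refine (hasFDerivAt_Ad (E := E) (g * h)).unique (h1.congr_of_eventuallyEq ?_)
  exact Eventually.of_forall fun z => by simp [mul_assoc]

theorem Ad_one : (Ad (1 : G) : E →L[ℝ] E) = ContinuousLinearMap.id ℝ E := by
  refine (hasFDerivAt_Ad (E := E) (1 : G)).unique ((hasFDerivAt_id _).congr_of_eventuallyEq ?_)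
  filter_upwards [eventually_oneChart_apply_symm] with z hz
  simp [hz]

theorem Ad_inv_apply_Ad (g : G) (v : E) : Ad g⁻¹ (Ad g v) = v := by
  have := Ad_mul (E := E) g⁻¹ g
  rw [inv_mul_cancel, Ad_one] at this
  exact (DFunLike.congr_fun this v).symm

theorem Ad_apply_Ad_inv (g : G) (v : E) : Ad g (Ad g⁻¹ v) = v := by
  simpa using Ad_inv_apply_Ad g⁻¹ v

/-- The product rule applied to the constant map `g g⁻¹`. -/
theorem maurerCartan_inv {g : D → G} {x : D} (hg : ContMDiffAt 𝓘(ℝ, D) 𝓘(ℝ, E) ∞ g x) (v : D) :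
    (maurerCartan (fun y => (g y)⁻¹) x v : E) = - Ad (g x) (maurerCartan g x v) := by
  have h := maurerCartan_mul hg hg.inv
  simp only [mul_inv_cancel, maurerCartan_const, inv_inv] at h
  have := DFunLike.congr_fun h v
  simp only [zero_apply, add_apply,
    ContinuousLinearMap.comp_apply] at this
  exact (neg_eq_of_add_eq_zero_right this.symm).symm

/-- The base point is both the parameter and the point of differentiation, so the map of two
variables `(g x)⁻¹ g y` is differentiated in `y` along the diagonal, near which it stays in the
chart. -/
theorem contDiff_maurerCartan {g : D → G} (hg : ContMDiff 𝓘(ℝ, D) 𝓘(ℝ, E) ∞ g) :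
    ContDiff ℝ ∞ (maurerCartan g : D → D →L[ℝ] E) := by
  have : (maurerCartan g : D → D →L[ℝ] E) =
      fun x => fderiv ℝ (fun y => oneChart E G ((g x)⁻¹ * g y)) x :=
    funext fun x => maurerCartan_eq_fderiv hg.contMDiffAt
  rw [this, contDiff_iff_contDiffAt]
  intro x
  refine ContDiffAt.fderiv (f := fun x y => oneChart E G ((g x)⁻¹ * g y)) (g := fun x => x)
    (n := ∞) ?_ contDiffAt_id (by simp)
  refine contDiffAt_oneChart_comp (g := fun z : D × D => (g z.1)⁻¹ * g z.2) ?_ (by simp)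
  exact ((hg.comp contDiff_fst.contMDiff).inv.mul (hg.comp contDiff_snd.contMDiff)).contMDiffAt

theorem contDiff_Ad {g : D → G} (hg : ContMDiff 𝓘(ℝ, D) 𝓘(ℝ, E) ∞ g) :
    ContDiff ℝ ∞ fun x => (Ad (g x) : E →L[ℝ] E) := by
  have : (fun x => (Ad (g x) : E →L[ℝ] E)) = fun x => fderiv ℝ
      (fun z => oneChart E G (g x * (oneChart E G).symm z * (g x)⁻¹)) (oneChart E G 1) :=
    funext fun x => (hasFDerivAt_Ad (g x)).fderiv.symm
  rw [this, contDiff_iff_contDiffAt]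
  intro x
  refine ContDiffAt.fderiv
    (f := fun x z => oneChart E G (g x * (oneChart E G).symm z * (g x)⁻¹))
    (g := fun x => oneChart E G 1) (n := ∞) ?_ contDiffAt_const (by simp)
  refine contDiffAt_oneChart_comp
    (g := fun z : D × E => g z.1 * (oneChart E G).symm z.2 * (g z.1)⁻¹) ?_
    (by simp [oneChart_symm_apply_one])
  have h1 := (hg.comp (contDiff_fst (E := D) (F := E)).contMDiff).contMDiffAt
    (x := (x, oneChart E G 1))
  exact (h1.mul (ContMDiffAt.comp (x, oneChart E G 1) (contMDiffAt_oneChart_symm (E := E) (G := G))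
    contDiffAt_snd.contMDiffAt)).mul h1.inv

end LieGroupCalculus

/-! ### The Lie bracket in the chart at the identity, and the Maurer-Cartan equation. -/

section MaurerCartanEquation

variable {E G : Type*} [NormedAddCommGroup E] [NormedSpace ℝ E]
  [TopologicalSpace G] [ChartedSpace E G] [Group G]
  {D : Type*} [NormedAddCommGroup D] [NormedSpace ℝ D]

variable (E G) in
/-- The left invariant vector fields near the identity, in the chart at the identity: the field with
value `v` at the identity has the value `leftField E G z v` at `z`. -/
noncomputable def leftField (z : E) : E →L[ℝ] E :=
  fderiv ℝ (fun y => oneChart E G ((oneChart E G).symm z * (oneChart E G).symm y)) (oneChart E G 1)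

variable (E G) in
/-- The left invariant Maurer-Cartan form near the identity, in the chart at the identity. -/
noncomputable def leftForm (z : E) : E →L[ℝ] E :=
  fderiv ℝ (fun y => oneChart E G (((oneChart E G).symm z)⁻¹ * (oneChart E G).symm y)) z

variable [LieGroup 𝓘(ℝ, E) ∞ G]

theorem contMDiffAt_fst_oneChart_symm :
    ContMDiffAt 𝓘(ℝ, E × E) 𝓘(ℝ, E) ∞ (fun z : E × E => (oneChart E G).symm z.1)
      (oneChart E G 1, oneChart E G 1) :=
  ContMDiffAt.comp (oneChart E G 1, oneChart E G 1) (f := Prod.fst)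
    contMDiffAt_oneChart_symm contDiffAt_fst.contMDiffAt

theorem contMDiffAt_snd_oneChart_symm :
    ContMDiffAt 𝓘(ℝ, E × E) 𝓘(ℝ, E) ∞ (fun z : E × E => (oneChart E G).symm z.2)
      (oneChart E G 1, oneChart E G 1) :=
  ContMDiffAt.comp (oneChart E G 1, oneChart E G 1) (f := Prod.snd)
    contMDiffAt_oneChart_symm contDiffAt_snd.contMDiffAt

theorem contDiffAt_leftField : ContDiffAt ℝ ∞ (leftField E G) (oneChart E G 1) := by
  refine ContDiffAt.fderiv (g := fun _ => oneChart E G 1) (n := ∞)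
    (f := fun z y => oneChart E G ((oneChart E G).symm z * (oneChart E G).symm y))
    ?_ contDiffAt_const (by simp)
  refine contDiffAt_oneChart_comp
    (g := fun z : E × E => (oneChart E G).symm z.1 * (oneChart E G).symm z.2) ?_
    (by simp [oneChart_symm_apply_one])
  exact contMDiffAt_fst_oneChart_symm.mul contMDiffAt_snd_oneChart_symm

theorem contDiffAt_leftForm : ContDiffAt ℝ ∞ (leftForm E G) (oneChart E G 1) := by
  refine ContDiffAt.fderiv (g := fun z => z) (n := ∞)
    (f := fun z y => oneChart E G (((oneChart E G).symm z)⁻¹ * (oneChart E G).symm y))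
    ?_ contDiffAt_id (by simp)
  refine contDiffAt_oneChart_comp
    (g := fun z : E × E => ((oneChart E G).symm z.1)⁻¹ * (oneChart E G).symm z.2) ?_
    (by simp [oneChart_symm_apply_one])
  exact contMDiffAt_fst_oneChart_symm.inv.mul contMDiffAt_snd_oneChart_symm

theorem eventually_contMDiffAt_oneChart_symm : ∀ᶠ z in 𝓝 (oneChart E G 1),
    ContMDiffAt 𝓘(ℝ, E) 𝓘(ℝ, E) ∞ (oneChart E G).symm z ∧
      (oneChart E G) ((oneChart E G).symm z) = z ∧
      ContMDiffAt 𝓘(ℝ, E) 𝓘(ℝ, E) ∞ (oneChart E G) ((oneChart E G).symm z) := by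
  have h := eventually_eventually_nhds.2 (oneChart_target_mem_nhds (E := E) (G := G))
  filter_upwards [h] with z hz
  have hz' : z ∈ (oneChart E G).target := mem_of_mem_nhds hz
  refine ⟨(contMDiffOn_extChartAt_symm (I := 𝓘(ℝ, E)) (n := ∞) (1 : G)).contMDiffAt hz,
    (oneChart E G).right_inv hz', contMDiffAt_extChartAt' ?_⟩
  rw [← extChartAt_source 𝓘(ℝ, E)]
  exact (oneChart E G).map_target hz'

omit [LieGroup 𝓘(ℝ, E) ∞ G] in
theorem leftField_one : leftField E G (oneChart E G 1) = ContinuousLinearMap.id ℝ E := by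
  have : HasFDerivAt
      (fun y => oneChart E G ((oneChart E G).symm (oneChart E G 1) * (oneChart E G).symm y))
      (ContinuousLinearMap.id ℝ E) (oneChart E G 1) := by
    refine (hasFDerivAt_id _).congr_of_eventuallyEq ?_
    filter_upwards [eventually_oneChart_apply_symm] with z hz
    simp [hz, oneChart_symm_apply_one]
  exact this.fderiv

omit [LieGroup 𝓘(ℝ, E) ∞ G] in
theorem leftForm_one : leftForm E G (oneChart E G 1) = ContinuousLinearMap.id ℝ E := by
  have : HasFDerivAt
      (fun y => oneChart E G (((oneChart E G).symm (oneChart E G 1))⁻¹ * (oneChart E G).symm y))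
      (ContinuousLinearMap.id ℝ E) (oneChart E G 1) := by
    refine (hasFDerivAt_id _).congr_of_eventuallyEq ?_
    filter_upwards [eventually_oneChart_apply_symm] with z hz
    simp [hz, oneChart_symm_apply_one]
  exact this.fderiv

/-- The chain rule for left translation by `z` followed by left translation by `z⁻¹`. -/
theorem eventually_leftForm_comp_leftField : ∀ᶠ z in 𝓝 (oneChart E G 1),
    (leftForm E G z).comp (leftField E G z) = ContinuousLinearMap.id ℝ E := by
  filter_upwards [eventually_contMDiffAt_oneChart_symm, oneChart_target_mem_nhds]
    with z ⟨hz, hz1, hz2⟩ hzt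
  set e := oneChart E G 1 with he
  set f := fun y => oneChart E G ((oneChart E G).symm z * (oneChart E G).symm y) with hf
  set k := fun y => oneChart E G (((oneChart E G).symm z)⁻¹ * (oneChart E G).symm y) with hk
  have he1 : f e = z := by simp [hf, he, oneChart_symm_apply_one, hz1]
  have hcf : ContinuousAt (fun y => (oneChart E G).symm z * (oneChart E G).symm y) e :=
    (contMDiffAt_const.mul contMDiffAt_oneChart_symm : ContMDiffAt 𝓘(ℝ, E) 𝓘(ℝ, E) ∞ _ e).continuousAt
  have hfd : DifferentiableAt ℝ f e := by
    have h1 : ContMDiffAt 𝓘(ℝ, E) 𝓘(ℝ, E) ∞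
        (fun y => (oneChart E G).symm z * (oneChart E G).symm y) e :=
      contMDiffAt_const.mul contMDiffAt_oneChart_symm
    have h2 : ContMDiffAt 𝓘(ℝ, E) 𝓘(ℝ, E) ∞ (oneChart E G)
        ((oneChart E G).symm z * (oneChart E G).symm e) := by
      rw [he, oneChart_symm_apply_one, mul_one]; exact hz2
    exact (h2.comp e h1).contDiffAt.differentiableAt (by simp)
  have hkd : DifferentiableAt ℝ k (f e) := by
    rw [he1]
    exact (contDiffAt_oneChart_comp (contMDiffAt_const.mul hz) (by simp)).differentiableAt (by simp)
  have h := hkd.hasFDerivAt.comp e hfd.hasFDerivAt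
  rw [he1] at h
  refine h.unique ((hasFDerivAt_id e).congr_of_eventuallyEq ?_)
  have hs : ∀ᶠ a in 𝓝 ((oneChart E G).symm z * (oneChart E G).symm e),
      (oneChart E G).symm (oneChart E G a) = a := by
    rw [he, oneChart_symm_apply_one, mul_one]
    filter_upwards [extChartAt_source_mem_nhds' (I := 𝓘(ℝ, E))
      ((oneChart E G).map_target hzt)] with a ha
    exact (oneChart E G).left_inv ha
  filter_upwards [hcf.eventually hs, eventually_oneChart_apply_symm] with y hy hy'
  simp [hf, hk, hy, hy']

/-- Differentiate `leftForm ∘ leftField = id` at the identity, where both factors are the identity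
map. This lets the Maurer-Cartan form be compared with the bracket, which is defined by vector
fields. -/
theorem fderiv_leftForm_apply (v w : E) :
    fderiv ℝ (leftForm E G) (oneChart E G 1) v w =
      - fderiv ℝ (leftField E G) (oneChart E G 1) v w := by
  have h1 := (contDiffAt_leftForm (E := E) (G := G)).differentiableAt (by simp) |>.hasFDerivAt
  have h2 := (contDiffAt_leftField (E := E) (G := G)).differentiableAt (by simp) |>.hasFDerivAt
  have h := (h1.clm_comp h2).unique ((hasFDerivAt_const (ContinuousLinearMap.id ℝ E)
    (oneChart E G 1)).congr_of_eventuallyEq eventually_leftForm_comp_leftField)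
  have := DFunLike.congr_fun (DFunLike.congr_fun h v) w
  simp [leftField_one, leftForm_one] at this
  rw [eq_neg_iff_add_eq_zero, add_comm]
  exact this

/-- Identifies the invariant fields behind the bracket of `GroupLieAlgebra` with explicit fields on
`E`, so that the bracket becomes a bracket of vector fields on a vector space. -/
theorem mpullbackWithin_mulInvariantVectorField (v : E) : ∀ᶠ z in 𝓝 (oneChart E G 1),
    (VectorField.mpullbackWithin 𝓘(ℝ, E) 𝓘(ℝ, E) (extChartAt 𝓘(ℝ, E) (1 : G)).symm
      (mulInvariantVectorField (I := 𝓘(ℝ, E)) (G := G) v) (Set.range 𝓘(ℝ, E)) z : E) =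
      leftField E G z v := by
  filter_upwards [eventually_contMDiffAt_oneChart_symm, oneChart_target_mem_nhds]
    with z ⟨hz, hz1, hz2⟩ hzt
  rw [VectorField.mpullbackWithin_apply, ContinuousLinearMap.inverse_eq
    (mfderivWithin_extChartAt_symm_comp_mfderiv_extChartAt hzt)
    (mfderiv_extChartAt_comp_mfderivWithin_extChartAt_symm hzt)]
  have hg : MDifferentiableAt 𝓘(ℝ, E) 𝓘(ℝ, E) (fun a : G => (oneChart E G).symm z * a) 1 :=
    (contMDiff_mul_left (I := 𝓘(ℝ, E)) (n := ∞)).mdifferentiableAt (by simp)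
  have hc := mfderiv_comp_apply_of_eq _ (hz2.mdifferentiableAt (by simp)) hg (mul_one _) v
  refine hc.symm.trans ?_
  refine DFunLike.congr_fun (F := E →L[ℝ] E) (?_ : _ = leftField E G z) v
  refine (if_pos ?_).trans ?_
  · exact MDifferentiableAt.comp_of_eq _ (hz2.mdifferentiableAt (by simp)) hg (mul_one _)
  · simp [writtenInExtChartAt, oneChart, Function.comp_def, leftField]
    rfl

theorem lieBr_eq (v w : E) : lieBr E G v w =
    fderiv ℝ (leftField E G) (oneChart E G 1) v w -
      fderiv ℝ (leftField E G) (oneChart E G 1) w v := by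
  have h : lieBr E G v w = VectorField.lieBracket ℝ (fun z => leftField E G z v)
      (fun z => leftField E G z w) (oneChart E G 1) := by
    refine (GroupLieAlgebra.bracket_def (I := 𝓘(ℝ, E)) (G := G) v w).trans ?_
    rw [← VectorField.mlieBracketWithin_univ,
      VectorField.mlieBracketWithin_apply]
    refine (DFunLike.congr_fun (F := E →L[ℝ] E) (?_ : _ = ContinuousLinearMap.id ℝ E) _).trans ?_
    · rw [mfderiv_extChartAt_self]
      exact ContinuousLinearMap.inverse_id
    have := Filter.EventuallyEq.lieBracketWithin_vectorField_eq_nhds (𝕜 := ℝ) (s := Set.univ)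
      (mpullbackWithin_mulInvariantVectorField (G := G) v)
      (mpullbackWithin_mulInvariantVectorField (G := G) w)
    rw [VectorField.lieBracketWithin_univ] at this
    simpa [oneChart] using this
  have hd := (contDiffAt_leftField (E := E) (G := G)).differentiableAt (by simp)
  have hv (v : E) : fderiv ℝ (fun z => leftField E G z v) (oneChart E G 1) =
      (fderiv ℝ (leftField E G) (oneChart E G 1)).flip v := by
    have := hd.hasFDerivAt.clm_apply (hasFDerivAt_const v (oneChart E G 1))
    rw [this.fderiv]
    ext; simp
  rw [h, VectorField.lieBracket, hv, hv]
  simp [leftField_one]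

/-- The Maurer-Cartan equation. -/
theorem fderiv_maurerCartan {g : D → G} (hg : ContMDiff 𝓘(ℝ, D) 𝓘(ℝ, E) ∞ g) (x v w : D) :
    fderiv ℝ (maurerCartan g : D → D →L[ℝ] E) x v w - fderiv ℝ (maurerCartan g) x w v =
      - lieBr E G (maurerCartan g x v) (maurerCartan g x w) := by
  -- Left translation does not change the Maurer-Cartan form, so `g` may be moved to pass through
  -- the identity at `x`. Near `x` the form is then the pullback of `leftForm` along `u`.
  set u : D → E := fun y => oneChart E G ((g x)⁻¹ * g y) with hu
  have hux : u x = oneChart E G 1 := by simp [hu]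
  have hgx : ContMDiff 𝓘(ℝ, D) 𝓘(ℝ, E) ∞ fun y => (g x)⁻¹ * g y := contMDiff_const.mul hg
  have hus : ContDiffAt ℝ ∞ u x := contDiffAt_oneChart_comp hgx.contMDiffAt (by simp)
  have hmc : maurerCartan g x = fderiv ℝ u x := maurerCartan_eq_fderiv hg.contMDiffAt
  have hev : (maurerCartan g : D → D →L[ℝ] E) =ᶠ[𝓝 x]
      fun y => (leftForm E G (u y)).comp (fderiv ℝ u y) := by
    have h1 : Tendsto (fun y => (g x)⁻¹ * g y) (𝓝 x) (𝓝 1) := by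
      simpa using hgx.continuous.tendsto x
    have h2 : Tendsto u (𝓝 x) (𝓝 (oneChart E G 1)) := by
      rw [← hux]; exact hus.continuousAt
    filter_upwards [h1.eventually (eventually_eventually_nhds.2
        (eventually_oneChart_symm_apply (E := E) (G := G))),
      h2.eventually (eventually_contMDiffAt_oneChart_symm (E := E) (G := G)),
      (hus.of_le (by simp : (1 : ℕ∞ω) ≤ ∞)).eventually (by simp)] with y hy1 hy2 hy3
    have hy0 : (oneChart E G).symm (u y) = (g x)⁻¹ * g y := hy1.self_of_nhds
    have hk := (contDiffAt_oneChart_comp (x := u y) (contMDiffAt_const.mul hy2.1)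
      (inv_mul_cancel ((oneChart E G).symm (u y)))).differentiableAt (by simp)
    have hf := hk.hasFDerivAt.comp y (hy3.differentiableAt (by simp)).hasFDerivAt
    rw [maurerCartan_eq_fderiv hg.contMDiffAt]
    refine HasFDerivAt.fderiv (hf.congr_of_eventuallyEq ?_)
    filter_upwards [hgx.continuous.continuousAt.eventually hy1] with z hz
    have hz0 : (oneChart E G).symm (u z) = (g x)⁻¹ * g z := hz
    simp only [Function.comp_apply, Pi.mul_apply, hy0, hz0]
    congr 1
    group
  have hD : HasFDerivAt (fderiv ℝ u) (fderiv ℝ (fderiv ℝ u) x) x :=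
    ((hus.fderiv_right (m := 1) (WithTop.coe_le_coe.2 le_top)).differentiableAt (by simp)).hasFDerivAt
  have hL := (contDiffAt_leftForm (E := E) (G := G)).differentiableAt (by simp) |>.hasFDerivAt
  rw [← hux] at hL
  have hT : HasFDerivAt (fun y => (leftForm E G (u y)).comp (fderiv ℝ u y)) _ x :=
    (hL.comp x (hus.differentiableAt (by simp)).hasFDerivAt).clm_comp hD
  have hsymm : ∀ v w, fderiv ℝ (fderiv ℝ u) x v w = fderiv ℝ (fderiv ℝ u) x w v :=
    hus.isSymmSndFDerivAt (by
      rw [minSmoothness_of_isRCLikeNormedField]; exact WithTop.coe_le_coe.2 le_top)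
  -- In the antisymmetrised product rule the second derivatives of `u` cancel. What remains is the
  -- derivative of `leftForm`, which is minus that of `leftField`.
  rw [hev.fderiv_eq, HasFDerivAt.fderiv hT, hmc, lieBr_eq]
  simp [hux, leftForm_one, fderiv_leftForm_apply, hsymm v w]
  abel

end MaurerCartanEquation

/-! ### Gauge covariance of the curvature. -/

section GaugeTransformations

variable {E G : Type*} [NormedAddCommGroup E] [NormedSpace ℝ E]
  [TopologicalSpace G] [ChartedSpace E G] [Group G]

variable (G) in
/-- The curvature `dα + ½ [α, α]` of a `𝔤`-valued `1`-form on a vector space. -/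
noncomputable def linCurvature {D : Type*} [NormedAddCommGroup D] [NormedSpace ℝ D]
    (α : D → D →L[ℝ] E) (x v w : D) : E :=
  fderiv ℝ α x v w - fderiv ℝ α x w v + lieBr E G (α x v) (α x w)

variable [LieGroup 𝓘(ℝ, E) ∞ G] {n : ℕ}

/-- Every `𝔤`-valued covector is the value of the Maurer-Cartan form of a map into `G`. -/
theorem exists_maurerCartan_eq (x : Euc n) (L : Euc n →L[ℝ] E) :
    ∃ h : Euc n → G, ContMDiff 𝓘(ℝ, Euc n) 𝓘(ℝ, E) ∞ h ∧ maurerCartan h x = L := by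
  let e := oneChart E G 1
  -- An affine map in the chart has the prescribed derivative. The retraction chosen below keeps it
  -- inside the chart target, so the map into `G` is smooth on all of `ℝⁿ`.
  let ℓ : Euc n → E := fun y => e + L (y - x)
  have hℓ : ContDiff ℝ ∞ ℓ := contDiff_const.add (L.contDiff.comp (contDiff_id.sub contDiff_const))
  have hℓx : ℓ x = e := by simp [ℓ]
  have ho : IsOpen (ℓ ⁻¹' (oneChart E G).target) :=
    (isOpen_extChartAt_target (I := 𝓘(ℝ, E)) (1 : G)).preimage hℓ.continuous
  have hx : x ∈ ℓ ⁻¹' (oneChart E G).target := by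
    rw [Set.mem_preimage, hℓx]; exact mem_extChartAt_target (I := 𝓘(ℝ, E)) (1 : G)
  obtain ⟨r, hr, hru, hrx⟩ := exists_smooth_retract ho hx
  have hh : ContMDiff 𝓘(ℝ, Euc n) 𝓘(ℝ, E) ∞ fun y => (oneChart E G).symm (ℓ (r y)) := fun y =>
    ((contMDiffOn_extChartAt_symm (I := 𝓘(ℝ, E)) (n := ∞) (1 : G)).contMDiffAt
      ((isOpen_extChartAt_target (I := 𝓘(ℝ, E)) (1 : G)).mem_nhds (hru y))).comp y
      (hℓ.comp hr).contMDiff.contMDiffAt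
  refine ⟨_, hh, (hasFDerivAt_maurerCartan hh.contMDiffAt).unique ?_⟩
  have hd : HasFDerivAt ℓ L x :=
    ((L.hasFDerivAt (x := x - x)).comp (f := fun y => y - x) x ((hasFDerivAt_id x).sub_const x)).const_add e
  refine hd.congr_of_eventuallyEq ?_
  filter_upwards [hrx] with y hy
  rw [hrx.self_of_nhds, hℓx, oneChart_symm_apply_one, inv_one, one_mul,
    (oneChart E G).right_inv (hru y), hy]

/-- Choose `h` whose Maurer-Cartan form agrees with `α` at `x`, and write `α = β + h⁻¹dh` with `β x
= 0`. The transform of `α` is then `Ad(g⁻¹) β + (hg)⁻¹d(hg)`. As `β x = 0`, the derivative of `Ad`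
contributes nothing at `x`, and the Maurer-Cartan equations of `h` and `hg` absorb the brackets.
Neither a formula for the derivative of `Ad` nor its compatibility with the bracket is needed. -/
theorem linCurvature_gauge {α : Euc n → Euc n →L[ℝ] E} {g : Euc n → G} {x : Euc n}
    (hα : DifferentiableAt ℝ α x) (hg : ContMDiff 𝓘(ℝ, Euc n) 𝓘(ℝ, E) ∞ g) (v w : Euc n) :
    linCurvature G (fun y => (Ad (g y)⁻¹ : E →L[ℝ] E).comp (α y) + maurerCartan g y) x v w =
      Ad (g x)⁻¹ (linCurvature G α x v w) := by
  obtain ⟨h, hh, hhx⟩ := exists_maurerCartan_eq (G := G) x (α x)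
  have hhg : ContMDiff 𝓘(ℝ, Euc n) 𝓘(ℝ, E) ∞ fun y => h y * g y := hh.mul hg
  set β : Euc n → Euc n →L[ℝ] E := fun y => α y - maurerCartan h y with hβ
  have hβx : β x = 0 := by simp [hβ, hhx]
  have dh := ((contDiff_maurerCartan hh).differentiable (by simp) x).hasFDerivAt
  have dhg := ((contDiff_maurerCartan hhg).differentiable (by simp) x).hasFDerivAt
  have dβ : HasFDerivAt β (fderiv ℝ α x - fderiv ℝ (maurerCartan h) x) x :=
    hα.hasFDerivAt.sub dh
  have dAd := ((contDiff_Ad (E := E) hg.inv).differentiable (by simp) x).hasFDerivAt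
  have hα' : (fun y => (Ad (g y)⁻¹ : E →L[ℝ] E).comp (α y) + maurerCartan g y) =
      fun y => (Ad (g y)⁻¹ : E →L[ℝ] E).comp (β y) + maurerCartan (fun z => h z * g z) y := by
    funext y
    rw [maurerCartan_mul hh.contMDiffAt hg.contMDiffAt, ← add_assoc, ← ContinuousLinearMap.comp_add,
      hβ, sub_add_cancel]
  have d : HasFDerivAt
      (fun y => (Ad (g y)⁻¹ : E →L[ℝ] E).comp (β y) + maurerCartan (fun z => h z * g z) y) _ x :=
    (dAd.clm_comp dβ).add dhg
  have e (v w : Euc n) : fderiv ℝ (fun y => ((Ad (g y)⁻¹ : E →L[ℝ] E).comp (β y) +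
      maurerCartan (fun z => h z * g z) y : Euc n →L[ℝ] E)) x v w =
      Ad (g x)⁻¹ (fderiv ℝ α x v w - fderiv ℝ (maurerCartan h) x v w) +
        fderiv ℝ (maurerCartan fun z => h z * g z) x v w := by
    rw [d.fderiv]
    simp [hβx]
  have m1 := eq_neg_iff_add_eq_zero.1 (fderiv_maurerCartan hh x v w)
  have m2 := eq_neg_iff_add_eq_zero.1 (fderiv_maurerCartan hhg x v w)
  rw [hhx, add_eq_zero_iff_neg_eq] at m1
  rw [add_eq_zero_iff_neg_eq] at m2
  rw [hα', linCurvature, linCurvature, e, e, hβx, ContinuousLinearMap.comp_zero, zero_add, ← m2,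
    ← m1]
  simp only [map_add, map_sub, map_neg]
  abel

end GaugeTransformations

/-! ### Locality and descent of differential forms -/

namespace DForm

variable {X Y : Type*} [DiffeologicalSpace X] [DiffeologicalSpace Y] {k : ℕ}
  {V : Type*} [NormedAddCommGroup V] [NormedSpace ℝ V]

theorem onPlot_comp_of_eventually_eq_id (a : DForm X k V) {n : ℕ} {p : Euc n → X} (hp : IsPlot p)
    {r : Euc n → Euc n} (hr : ContDiff ℝ ∞ r) {x : Euc n} (hrx : ∀ᶠ y in 𝓝 x, r y = y) :
    a.onPlot (p ∘ r) (isPlot_reparam hp hr) x = a.onPlot p hp x := by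
  have hd : fderiv ℝ r x = ContinuousLinearMap.id ℝ (Euc n) := by
    rw [Filter.EventuallyEq.fderiv_eq (hrx : r =ᶠ[𝓝 x] fun y => y), fderiv_fun_id]
  rw [a.reparam p hp r hr x, hd, hrx.self_of_nhds]
  ext v
  rfl

/-- Plots are defined on all of `ℝⁿ`. Composing both with a smooth retraction into the set of
agreement makes them equal everywhere without changing the germ at `x`. -/
theorem onPlot_congr_of_eventuallyEq (a : DForm X k V) {n : ℕ} {p q : Euc n → X} (hp : IsPlot p)
    (hq : IsPlot q) {x : Euc n} (h : ∀ᶠ y in 𝓝 x, p y = q y) :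
    a.onPlot p hp x = a.onPlot q hq x := by
  obtain ⟨u, hu, huo, hxu⟩ := eventually_nhds_iff.1 h
  obtain ⟨r, hr, hru, hrx⟩ := exists_smooth_retract huo hxu
  rw [← a.onPlot_comp_of_eventually_eq_id hp hr hrx, ← a.onPlot_comp_of_eventually_eq_id hq hr hrx]
  exact congrFun (a.congr_plot (funext fun y => hu _ (hru y)) _ _) x

/-- `φ : X → Y` is a subduction: the plots of `Y` lift locally to `X`. -/
def _root_.HasLocalLifts (φ : X → Y) : Prop :=
  ∀ {n : ℕ} (r : Euc n → Y), IsPlot r → ∀ x, ∃ q : Euc n → X, IsPlot q ∧ ∀ᶠ y in 𝓝 x, φ (q y) = r y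

/-- The descended form is evaluated at each point through a local lift of the plot. The hypothesis
`ha` makes the value independent of the lift, and smoothness and naturality are then inherited from
`a`. -/
theorem exists_pullback_eq {φ : X → Y} (hφ : DSmooth φ) (hs : HasLocalLifts φ) (a : DForm X k V)
    (ha : ∀ {n : ℕ} (q q' : Euc n → X) (hq : IsPlot q) (hq' : IsPlot q'),
      (∀ x, φ (q x) = φ (q' x)) → ∀ x, a.onPlot q hq x = a.onPlot q' hq' x) :
    ∃ b : DForm Y k V, b.pullback φ hφ = a := by
  -- Lifts agree over `Y` only near a point, so `ha` is needed in this local form.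
  have loc : ∀ {n : ℕ} (q q' : Euc n → X) (hq : IsPlot q) (hq' : IsPlot q') (x : Euc n),
      (∀ᶠ y in 𝓝 x, φ (q y) = φ (q' y)) → a.onPlot q hq x = a.onPlot q' hq' x := by
    intro n q q' hq hq' x h
    obtain ⟨u, hu, huo, hxu⟩ := eventually_nhds_iff.1 h
    obtain ⟨r, hr, hru, hrx⟩ := exists_smooth_retract huo hxu
    rw [← a.onPlot_comp_of_eventually_eq_id hq hr hrx,
      ← a.onPlot_comp_of_eventually_eq_id hq' hr hrx]
    exact ha _ _ _ _ (fun y => hu _ (hru y)) x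
  choose L hL hLφ using @hs
  have key : ∀ {n : ℕ} (r : Euc n → Y) (hr : IsPlot r) (q : Euc n → X) (hq : IsPlot q) (x : Euc n),
      (∀ᶠ y in 𝓝 x, φ (q y) = r y) → a.onPlot (L r hr x) (hL r hr x) x = a.onPlot q hq x := by
    intro n r hr q hq x h
    refine loc _ _ _ _ x ?_
    filter_upwards [h, hLφ r hr x] with y h1 h2
    rw [h1, h2]
  refine ⟨⟨fun r hr x => a.onPlot (L r hr x) (hL r hr x) x, fun r hr => ?_,
    fun r hr h hh x => ?_⟩, ?_⟩
  · rw [contDiff_iff_contDiffAt]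
    intro x
    refine (a.smooth (L r hr x) (hL r hr x)).contDiffAt.congr_of_eventuallyEq ?_
    -- The lift chosen at `x` is also a lift near each nearby `y`, so close to `x` the whole form is
    -- computed by this one lift.
    filter_upwards [eventually_eventually_nhds.2 (hLφ r hr x)] with y hy
    exact key r hr _ _ y hy
  · refine (key (r ∘ h) (isPlot_reparam hr hh) (L r hr (h x) ∘ h)
      (isPlot_reparam (hL r hr (h x)) hh) x
      (hh.continuous.continuousAt.eventually (hLφ r hr (h x)))).trans ?_
    exact a.reparam _ _ h hh x
  · ext n p hp x v
    exact DFunLike.congr_fun (key (φ ∘ p) (hp.dSmooth_comp hφ) p hp x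
      (Eventually.of_forall fun _ => rfl)) v

theorem pullback_descend {φ : X → Y} (hφ : DSmooth φ) {a : DForm X k V}
    (h : ∃ b : DForm Y k V, b.pullback φ hφ = a) : (a.descend φ hφ).pullback φ hφ = a := by
  rw [descend, dif_pos h]
  exact h.choose_spec

end DForm

/-! ### Forms of degree one and their curvature -/

/-- An alternating map in one variable, as a linear map. -/
noncomputable def toLin {D V : Type*} [NormedAddCommGroup D] [NormedSpace ℝ D]
    [NormedAddCommGroup V] [NormedSpace ℝ V] :
    (D [⋀^Fin 1]→L[ℝ] V) ≃ₗᵢ[ℝ] (D →L[ℝ] V) :=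
  (ContinuousAlternatingMap.ofSubsingletonLIE (𝕜 := ℝ) (E := D) (F := V) (0 : Fin 1)).symm

section ToLin

variable {D V : Type*} [NormedAddCommGroup D] [NormedSpace ℝ D] [NormedAddCommGroup V]
  [NormedSpace ℝ V]

theorem toLin_apply (a : D [⋀^Fin 1]→L[ℝ] V) (v : D) : toLin a v = a fun _ => v := rfl

theorem toLin_symm_apply (a : D →L[ℝ] V) (v : Fin 1 → D) : toLin.symm a v = a (v 0) := rfl

theorem extDeriv_apply_two {a : D → D [⋀^Fin 1]→L[ℝ] V} {x : D} (ha : DifferentiableAt ℝ a x)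
    (v : Fin 2 → D) : extDeriv a x v =
      fderiv ℝ (fun y => toLin (a y)) x (v 0) (v 1) -
        fderiv ℝ (fun y => toLin (a y)) x (v 1) (v 0) := by
  have hd : HasFDerivAt (fun y => toLin (a y)) _ x :=
    (toLin (D := D) (V := V)).toContinuousLinearEquiv.hasFDerivAt.comp x ha.hasFDerivAt
  have h (w : Fin 1 → D) (u : D) :
      fderiv ℝ (fun y => a y w) x u = fderiv ℝ (fun y => toLin (a y)) x u (w 0) := by
    have h1 := hd.clm_apply (hasFDerivAt_const (w 0) x)
    have h2 : (fun y => toLin (a y) (w 0)) = fun y => a y w := by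
      funext y
      rw [toLin_apply]
      congr 1
      funext i
      rw [Fin.fin_one_eq_zero i]
    rw [← h2, h1.fderiv, hd.fderiv]
    simp
  rw [extDeriv_apply ha]
  simp only [h]
  simp [Fin.removeNth, sub_eq_add_neg]

end ToLin

section Curvature

variable {E G : Type*} [NormedAddCommGroup E] [NormedSpace ℝ E]
  [TopologicalSpace G] [ChartedSpace E G] [Group G] [LieGroup 𝓘(ℝ, E) ∞ G]

theorem lieBr_swap (v w : E) : lieBr E G w v = - lieBr E G v w := by
  rw [lieBr_eq, lieBr_eq, neg_sub]

variable [FiniteDimensional ℝ E] {X Y : Type*} [DiffeologicalSpace X] [DiffeologicalSpace Y]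

theorem wedge₂_lieBr_one_one (A B : DForm X 1 E) {n : ℕ} (p : Euc n → X) (hp : IsPlot p)
    (x : Euc n) (v : Fin 2 → Euc n) :
    (DForm.wedge₂ (lieBrMultilinear E G) A B).onPlot p hp x v =
      lieBr E G (A.onPlot p hp x fun _ => v 0) (B.onPlot p hp x fun _ => v 1) -
        lieBr E G (A.onPlot p hp x fun _ => v 1) (B.onPlot p hp x fun _ => v 0) := by
  have hu : (Finset.univ : Finset (Equiv.Perm (Fin (1 + 1)))) = {1, Equiv.swap 0 1} := by decide
  rw [DForm.wedge₂, DForm.wedge, wedgeAlt_apply, hu, Finset.sum_pair (by decide)]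
  simp only [lieBrMultilinear_apply]
  simp
  rw [← sub_eq_add_neg]
  refine congrArg₂ _ (congrArg₂ _ (congrArg (A.onPlot p hp x) (funext fun j : Fin 1 => ?_))
    (congrArg (B.onPlot p hp x) (funext fun j : Fin 1 => ?_)))
    (congrArg₂ _ (congrArg (A.onPlot p hp x) (funext fun j : Fin 1 => ?_))
    (congrArg (B.onPlot p hp x) (funext fun j : Fin 1 => ?_)))
  all_goals
    rw [Fin.fin_one_eq_zero j]
    rfl

theorem wedge₂_lieBr_one_zero (A : DForm X 1 E) (B : DForm X 0 E) {n : ℕ} (p : Euc n → X)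
    (hp : IsPlot p) (x : Euc n) (v : Fin 1 → Euc n) :
    (DForm.wedge₂ (lieBrMultilinear E G) A B).onPlot p hp x v =
      lieBr E G (A.onPlot p hp x v) (B.onPlot p hp x ![]) := by
  have hu : (Finset.univ : Finset (Equiv.Perm (Fin (1 + 0)))) = {1} := by decide
  rw [DForm.wedge₂, DForm.wedge, wedgeAlt_apply, hu, Finset.sum_singleton]
  simp only [lieBrMultilinear_apply]
  simp
  refine congrArg₂ _ (congrArg (A.onPlot p hp x) (funext fun j : Fin 1 => ?_))
    (congrArg (B.onPlot p hp x) (Subsingleton.elim (α := Fin 0 → Euc n) _ _))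
  rw [Fin.fin_one_eq_zero j]
  rfl

/-- The wedge normalisation gives `[A, A](v, w) = 2 [A v, A w]`, which absorbs the factor `½`. -/
theorem curvature_onPlot_apply (A : DForm X 1 E) {n : ℕ} (p : Euc n → X) (hp : IsPlot p)
    (x : Euc n) (v : Fin 2 → Euc n) :
    (curvature G A).onPlot p hp x v =
      linCurvature G (fun y => toLin (A.onPlot p hp y)) x (v 0) (v 1) := by
  have h : (curvature G A).onPlot p hp x v = extDeriv (A.onPlot p hp) x v +
      (1 / 2 : ℝ) • (DForm.wedge₂ (lieBrMultilinear E G) A A).onPlot p hp x v := rfl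
  rw [h, extDeriv_apply_two ((A.smooth p hp).differentiable (by simp) x), wedge₂_lieBr_one_one,
    lieBr_swap (A.onPlot p hp x fun _ => v 0), sub_neg_eq_add, ← two_smul ℝ, smul_smul,
    linCurvature]
  norm_num [toLin_apply]

theorem curvature_pullback (φ : X → Y) (hφ : DSmooth φ) (A : DForm Y 1 E) :
    curvature G (A.pullback φ hφ) = (curvature G A).pullback φ hφ := rfl

omit [LieGroup 𝓘(ℝ, E) ∞ G] [FiniteDimensional ℝ E] in
theorem polyCurvature_pullback (φ : X → Y) (hφ : DSmooth φ) {k : ℕ} (f : InvariantPolynomial E G k)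
    (F : DForm Y 2 E) : polyCurvature f (F.pullback φ hφ) = (polyCurvature f F).pullback φ hφ := rfl

end Curvature

/-! ### Local lifts of the angle, and loops evaluated at a moving angle. -/

section CircleAndLoops

variable {E G : Type*} [NormedAddCommGroup E] [NormedSpace ℝ E]
  [TopologicalSpace G] [ChartedSpace E G] [Group G] [LieGroup 𝓘(ℝ, E) ∞ G]
  {D : Type*} [NormedAddCommGroup D] [NormedSpace ℝ D]

theorem Real.Angle.exists_contDiff_lift {n : ℕ} {c : Euc n → Real.Angle} (hc : IsPlot c)
    (x : Euc n) : ∃ s : Euc n → ℝ, ContDiff ℝ ∞ s ∧ ∀ᶠ y in 𝓝 x, c y = (s y : Real.Angle) := by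
  obtain ⟨s, hs, h⟩ := hc x
  exact ⟨s, hs.contDiff, h.mono fun y hy => hy.symm⟩

/-- Near `x` the difference `s y - s x` lies in `(-π, π)`, where `toReal` recovers the real number
from its angle. -/
theorem dTheta_eq_fderiv {c : D → Real.Angle} {s : D → ℝ} {x : D} (hs : ContinuousAt s x)
    (h : ∀ᶠ y in 𝓝 x, c y = (s y : Real.Angle)) : dTheta c x = fderiv ℝ s x := by
  have h1 : (fun y => (c y - c x).toReal) =ᶠ[𝓝 x] fun y => s y - s x := by
    have h2 : ∀ᶠ y in 𝓝 x, s y - s x ∈ Set.Ioo (-Real.pi) Real.pi := by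
      have : Tendsto (fun y => s y - s x) (𝓝 x) (𝓝 0) := by
        simpa using hs.tendsto.sub_const (s x)
      exact this.eventually (Ioo_mem_nhds (by linarith [Real.pi_pos]) Real.pi_pos)
    filter_upwards [h, h2] with y hy hy2
    rw [hy, h.self_of_nhds, ← Real.Angle.coe_sub, Real.Angle.toReal_coe_eq_self_iff]
    exact ⟨hy2.1, hy2.2.le⟩
  rw [dTheta, h1.fderiv_eq, fderiv_sub_const]

theorem maurerCartan_congr_of_eventuallyEq {g h : D → G} {x : D}
    (hg : ContMDiffAt 𝓘(ℝ, D) 𝓘(ℝ, E) ∞ g x) (hgh : g =ᶠ[𝓝 x] h) :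
    (maurerCartan g x : D →L[ℝ] E) = maurerCartan h x := by
  rw [maurerCartan_eq_fderiv hg, maurerCartan_eq_fderiv (hg.congr_of_eventuallyEq hgh.symm)]
  refine Filter.EventuallyEq.fderiv_eq ?_
  filter_upwards [hgh] with y hy
  rw [hy, hgh.self_of_nhds]

theorem LoopGroup.contMDiff_eval_real {n : ℕ} {γ : Euc n → LoopGroup E G} (hγ : IsPlot γ)
    {s : Euc n → ℝ} (hs : ContDiff ℝ ∞ s) :
    ContMDiff 𝓘(ℝ, Euc n) 𝓘(ℝ, E) ∞ fun y => (γ y).1 (s y : Real.Angle) :=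
  ContMDiff.comp (g := fun y : Euc n × ℝ => (γ y.1).1 (y.2 : Real.Angle)) hγ
    (contDiff_id.prodMk hs).contMDiff

theorem LoopGroup.contMDiff_eval {n : ℕ} {γ : Euc n → LoopGroup E G} (hγ : IsPlot γ)
    {c : Euc n → Real.Angle} (hc : IsPlot c) :
    ContMDiff 𝓘(ℝ, Euc n) 𝓘(ℝ, E) ∞ fun y => (γ y).1 (c y) := by
  intro x
  obtain ⟨s, hs, h⟩ := Real.Angle.exists_contDiff_lift hc x
  refine (LoopGroup.contMDiff_eval_real hγ hs x).congr_of_eventuallyEq ?_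
  filter_upwards [h] with y hy
  rw [hy]

/-- The Maurer-Cartan form of a family of loops, evaluated at a varying angle. -/
theorem LoopGroup.maurerCartan_eval {n : ℕ} {γ : Euc n → LoopGroup E G} (hγ : IsPlot γ)
    {c : Euc n → Real.Angle} (hc : IsPlot c) (x v : Euc n) :
    (maurerCartan (fun y => (γ y).1 (c y)) x v : E) =
      maurerCartan (fun y => (γ y).1 (c x)) x v + dTheta c x v • loopLogDeriv (γ x) (c x) := by
  obtain ⟨s, hs, h⟩ := Real.Angle.exists_contDiff_lift hc x
  have hsx := h.self_of_nhds
  -- All three terms are pullbacks of the Maurer-Cartan form of `Γ`, along `y ↦ (y, s y)`, `y ↦ (y,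
  -- s x)` and `t ↦ (x, s x + t)`. The velocity of the first is the sum of the velocities of the
  -- other two, the last scaled by `ds`.
  set Γ : Euc n × ℝ → G := fun y => (γ y.1).1 (y.2 : Real.Angle) with hΓ
  have hΓs : ContMDiff 𝓘(ℝ, Euc n × ℝ) 𝓘(ℝ, E) ∞ Γ := hγ
  have hds := (hs.differentiable (by simp) x).hasFDerivAt
  have e1 : (maurerCartan (fun y => (γ y).1 (c y)) x : Euc n →L[ℝ] E) =
      maurerCartan (fun y => Γ (y, s y)) x :=
    maurerCartan_congr_of_eventuallyEq (LoopGroup.contMDiff_eval hγ hc x)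
      (h.mono fun y hy => by simp only [hΓ, hy])
  have e2 := maurerCartan_comp (h := fun y => (y, s y)) hΓs.contMDiffAt
    (contDiff_id.prodMk hs).contDiffAt (x := x)
  have e3 := maurerCartan_comp (h := fun y : Euc n => (y, s x)) hΓs.contMDiffAt
    (contDiff_id.prodMk contDiff_const).contDiffAt (x := x)
  have e4 := maurerCartan_comp (h := fun t : ℝ => (x, s x + t)) hΓs.contMDiffAt
    (contDiff_const.prodMk (contDiff_const.add contDiff_id)).contDiffAt (x := (0 : ℝ))
  have d2 : HasFDerivAt (fun y => (y, s y)) _ x := (hasFDerivAt_id (𝕜 := ℝ) x).prodMk hds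
  have d3 : HasFDerivAt (fun y : Euc n => (y, s x)) _ x :=
    (hasFDerivAt_id (𝕜 := ℝ) x).prodMk (hasFDerivAt_const _ _)
  have d4 : HasFDerivAt (fun t : ℝ => (x, s x + t)) _ 0 :=
    (hasFDerivAt_const x (0 : ℝ)).prodMk ((hasFDerivAt_id (𝕜 := ℝ) (0 : ℝ)).const_add (s x))
  have e5 : loopLogDeriv (γ x) (c x) = maurerCartan (fun t : ℝ => Γ (x, s x + t)) 0 1 := by
    simp [loopLogDeriv, hΓ, hsx]
  rw [e1, e2, e5, e4, hsx, e3, d2.fderiv, d3.fderiv, d4.fderiv,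
    dTheta_eq_fderiv hs.continuous.continuousAt h]
  simp only [ContinuousLinearMap.comp_apply, ContinuousLinearMap.prod_apply, add_zero, zero_apply,
    ContinuousLinearMap.id_apply]
  rw [← map_smul, ← map_add]
  simp

end CircleAndLoops

/-! ### Connections under smoothly varying gauge transformations. -/

section Equivariance

variable {X V : Type*} [DiffeologicalSpace X] [NormedAddCommGroup V] [NormedSpace ℝ V]

/-- The straight line through `x` with velocity `v`. -/
def lineEuc {n : ℕ} (x v : Euc n) (t : Euc 1) : Euc n := x + t 0 • v

theorem contDiff_lineEuc {n : ℕ} (x v : Euc n) : ContDiff ℝ ∞ (lineEuc x v) :=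
  contDiff_const.add ((EuclideanSpace.proj (0 : Fin 1) : Euc 1 →L[ℝ] ℝ).contDiff.smul
    contDiff_const)

theorem lineEuc_zero {n : ℕ} (x v : Euc n) : lineEuc x v 0 = x := by simp [lineEuc]

theorem fderiv_lineEuc {n : ℕ} (x v : Euc n) :
    fderiv ℝ (lineEuc x v) 0 (EuclideanSpace.single 0 1) = v := by
  have h : HasFDerivAt (lineEuc x v) _ 0 :=
    ((EuclideanSpace.proj (0 : Fin 1) : Euc 1 →L[ℝ] ℝ).hasFDerivAt.smul_const v).const_add x
  rw [h.fderiv]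
  simp

/-- A one-form on a tangent vector is determined by its pullback to a line with that velocity.
Values along different plots can thus be compared by exhibiting one common curve. -/
theorem DForm.toLin_onPlot_comp_lineEuc (a : DForm X 1 V) {n : ℕ} (q : Euc n → X) (hq : IsPlot q)
    (x v : Euc n) :
    toLin (a.onPlot (q ∘ lineEuc x v) (isPlot_reparam hq (contDiff_lineEuc x v)) 0)
      (EuclideanSpace.single 0 1) = toLin (a.onPlot q hq x) v := by
  rw [a.reparam q hq _ (contDiff_lineEuc x v) 0, toLin_apply, toLin_apply,
    ContinuousAlternatingMap.compContinuousLinearMap_apply, lineEuc_zero]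
  congr 1
  funext i
  exact fderiv_lineEuc x v

variable {E G : Type*} [NormedAddCommGroup E] [NormedSpace ℝ E]
  [TopologicalSpace G] [ChartedSpace E G] [Group G] [LieGroup 𝓘(ℝ, E) ∞ G]
  {P M : Type*} [DiffeologicalSpace P] [DiffeologicalSpace M]
  [MulAction (LoopGroup E G)ᵐᵒᵖ P] {π : P → M}

theorem LoopGroup.isPlot_const_mul {n : ℕ} (δ : LoopGroup E G) {γ : Euc n → LoopGroup E G}
    (hγ : IsPlot γ) : IsPlot fun x => δ * γ x := by
  have h : ContMDiff 𝓘(ℝ, Euc n × ℝ) 𝓘(ℝ, E) ∞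
      fun y : Euc n × ℝ => δ.1 (y.2 : Real.Angle) * (γ y.1).1 (y.2 : Real.Angle) :=
    (δ.2.1.comp (contDiff_snd (E := Euc n) (F := ℝ)).contMDiff).mul hγ
  exact h

theorem IsPrincipalBundle.isPlot_smul (hπ : IsPrincipalBundle (LoopGroup E G) π) {n : ℕ}
    {p : Euc n → P} (hp : IsPlot p) {γ : Euc n → LoopGroup E G} (hγ : IsPlot γ) :
    IsPlot fun y => MulOpposite.op (γ y) • p y :=
  hπ.smooth_action n (fun y => (p y, γ y)) ⟨hp, hγ⟩

/-- The behaviour of a connection under a smooth family of gauge transformations. -/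
theorem LoopConnection.toLin_onPlot_smul {hπ : IsPrincipalBundle (LoopGroup E G) π}
    (A : LoopConnection hπ) (θ : Real.Angle) {n : ℕ} {p : Euc n → P} (hp : IsPlot p)
    {γ : Euc n → LoopGroup E G} (hγ : IsPlot γ) (x v : Euc n) :
    toLin ((A.form θ).onPlot (fun y => MulOpposite.op (γ y) • p y) (hπ.isPlot_smul hp hγ) x) v =
      Ad ((γ x).1 θ)⁻¹ (toLin ((A.form θ).onPlot p hp x) v) +
        maurerCartan (fun y => (γ y).1 θ) x v := by
  have hl (i : Fin 2) : ContDiff ℝ ∞ fun z : Euc 2 => x + z i • v :=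
    contDiff_const.add ((EuclideanSpace.proj i : Euc 2 →L[ℝ] ℝ).contDiff.smul contDiff_const)
  -- The point and the gauge transformation move with independent times. The required curve is the
  -- diagonal of `F`. By linearity its velocity splits into `w₀`, with `γ` frozen, handled by
  -- `equivariant`, and `w₁`, with `p` frozen, handled by `vertical`.
  let F : Euc 2 → P := fun z => MulOpposite.op (γ (x + z 1 • v)) • p (x + z 0 • v)
  have hF : IsPlot F := hπ.isPlot_smul (isPlot_reparam hp (hl 0)) (isPlot_reparam hγ (hl 1))
  let w₀ : Euc 2 := EuclideanSpace.single 0 1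
  let w₁ : Euc 2 := EuclideanSpace.single 1 1
  have hγl := isPlot_reparam hγ (contDiff_lineEuc x v)
  have hpl := isPlot_reparam hp (contDiff_lineEuc x v)
  have hcong : ∀ {q q' : Euc 1 → P} (hq : IsPlot q) (hq' : IsPlot q'), q = q' →
      toLin ((A.form θ).onPlot q hq 0) (EuclideanSpace.single 0 1) =
        toLin ((A.form θ).onPlot q' hq' 0) (EuclideanSpace.single 0 1) := by
    intro q q' hq hq' h
    rw [(A.form θ).congr_plot h hq hq']
  have hdiag := hcong (isPlot_reparam (hπ.isPlot_smul hp hγ) (contDiff_lineEuc x v))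
    (isPlot_reparam hF (contDiff_lineEuc 0 (w₀ + w₁)))
    (by funext t; simp [lineEuc, F, w₀, w₁])
  have h0 := hcong (isPlot_reparam hF (contDiff_lineEuc 0 w₀)) (hpl.dSmooth_comp
    (hπ.dSmooth_smul (γ x))) (by funext t; simp [lineEuc, F, w₀])
  -- The axiom `vertical` wants a family through `1`, so the frozen point is taken to be `p x · γ x`
  -- and the family `(γ x)⁻¹ γ`.
  have hc := LoopGroup.isPlot_const_mul (γ x)⁻¹ hγl
  have h1 := hcong (isPlot_reparam hF (contDiff_lineEuc 0 w₁)) (hc.dSmooth_comp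
    (hπ.dSmooth_orbit (MulOpposite.op (γ x) • p x)))
    (by funext t; simp [lineEuc, F, w₁, smul_smul, ← MulOpposite.op_mul])
  rw [DForm.toLin_onPlot_comp_lineEuc _ F hF] at hdiag h0 h1
  rw [DForm.toLin_onPlot_comp_lineEuc _ _ (hπ.isPlot_smul hp hγ), map_add, h0, h1] at hdiag
  rw [hdiag]
  refine congrArg₂ _ ?_ ?_
  · rw [← DForm.toLin_onPlot_comp_lineEuc _ p hp]
    exact A.equivariant (γ x) θ _ hpl 0 _
  · refine (A.vertical (MulOpposite.op (γ x) • p x) θ _ hc (by simp [lineEuc_zero]) _).trans ?_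
    have e := maurerCartan_comp (h := lineEuc x v) (x := 0)
      (LoopGroup.contMDiff_eval hγ (c := fun _ => θ) isPlot_const).contMDiffAt
      (contDiff_lineEuc x v).contDiffAt
    have e' := DFunLike.congr_fun e (EuclideanSpace.single 0 1)
    rw [ContinuousLinearMap.comp_apply, fderiv_lineEuc, lineEuc_zero] at e'
    rw [← e']
    exact DFunLike.congr_fun (maurerCartan_const_mul ((γ x)⁻¹.1 θ)
      (h := fun t => (γ (lineEuc x v t)).1 θ)) _

end Equivariance

theorem DForm.pullback_injective {X Y : Type*} [DiffeologicalSpace X] [DiffeologicalSpace Y] {k : ℕ}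
    {V : Type*} [NormedAddCommGroup V] [NormedSpace ℝ V] {φ : X → Y} (hφ : DSmooth φ)
    (hs : HasLocalLifts φ) {a b : DForm Y k V} (h : a.pullback φ hφ = b.pullback φ hφ) : a = b := by
  ext n r hr x v
  obtain ⟨q, hq, hqr⟩ := hs r hr x
  have e : ∀ c : DForm Y k V, c.onPlot r hr x = (c.pullback φ hφ).onPlot q hq x := fun c =>
    (c.onPlot_congr_of_eventuallyEq (hq.dSmooth_comp hφ) hr hqr).symm
  rw [e, e, h]

/-! ### The caloron connection, its curvature, and descent to `M × S¹`. -/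

section CaloronConnection

variable {E G P M : Type*} [NormedAddCommGroup E] [NormedSpace ℝ E]
  [TopologicalSpace G] [ChartedSpace E G] [Group G] [LieGroup 𝓘(ℝ, E) ∞ G]
  [DiffeologicalSpace P] [DiffeologicalSpace M]
  [MulAction (LoopGroup E G)ᵐᵒᵖ P] {π : P → M} {hπ : IsPrincipalBundle (LoopGroup E G) π}

/-- The form `A(θ) + Φ dθ`, on a plot of `P × S¹`. -/
noncomputable def higgsConnection (A : LoopConnection hπ) (Φ : HiggsField hπ) {n : ℕ}
    (p : Euc n → P) (hp : IsPlot p) (c : Euc n → Real.Angle) (x : Euc n) : Euc n →L[ℝ] E :=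
  toLin ((A.form (c x)).onPlot p hp x) + (dTheta c x).smulRight (Φ.toFun (p x) (c x))

variable (A : LoopConnection hπ) (Φ : HiggsField hπ) {n : ℕ} {p : Euc n → P} (hp : IsPlot p)
  {c : Euc n → Real.Angle}

theorem higgsConnection_eventuallyEq {s : Euc n → ℝ} (hs : ContDiff ℝ ∞ s) {x : Euc n}
    (h : ∀ᶠ y in 𝓝 x, c y = (s y : Real.Angle)) :
    higgsConnection A Φ p hp c =ᶠ[𝓝 x] fun y =>
      toLin ((A.form (s y : Real.Angle)).onPlot p hp y) +
        (fderiv ℝ s y).smulRight (Φ.toFun (p y) (s y : Real.Angle)) := by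
  filter_upwards [eventually_eventually_nhds.2 h] with y hy
  rw [higgsConnection, dTheta_eq_fderiv hs.continuous.continuousAt hy, hy.self_of_nhds]

theorem contDiff_higgsConnection (hc : IsPlot c) : ContDiff ℝ ∞ (higgsConnection A Φ p hp c) := by
  rw [contDiff_iff_contDiffAt]
  intro x
  obtain ⟨s, hs, h⟩ := Real.Angle.exists_contDiff_lift hc x
  refine ContDiffAt.congr_of_eventuallyEq (ContDiff.contDiffAt ?_)
    (higgsConnection_eventuallyEq A Φ hp hs h)
  refine ContDiff.add ?_ ?_
  · exact (toLin (D := Euc n) (V := E)).contDiff.comp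
      ((A.smooth n p hp).comp (contDiff_id.prodMk hs))
  · exact (hs.fderiv_right (by simp)).smulRight ((Φ.smooth p hp).comp (contDiff_id.prodMk hs))

theorem higgsConnection_comp (hc : IsPlot c) {m : ℕ} {h : Euc m → Euc n} (hh : ContDiff ℝ ∞ h)
    (x : Euc m) : higgsConnection A Φ (p ∘ h) (isPlot_reparam hp hh) (c ∘ h) x =
      (higgsConnection A Φ p hp c (h x)).comp (fderiv ℝ h x) := by
  obtain ⟨s, hs, hsc⟩ := Real.Angle.exists_contDiff_lift hc (h x)
  have hd : dTheta (c ∘ h) x = (dTheta c (h x)).comp (fderiv ℝ h x) := by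
    have e : dTheta (c ∘ h) x = fderiv ℝ (s ∘ h) x :=
      dTheta_eq_fderiv (hs.continuous.comp hh.continuous).continuousAt
        (hh.continuous.continuousAt.eventually hsc)
    rw [e, dTheta_eq_fderiv hs.continuous.continuousAt hsc, fderiv_comp x (hs.differentiable (by simp) _) (hh.differentiable (by simp) x)]
  ext v
  rw [higgsConnection, higgsConnection, hd]
  simp only [Function.comp_apply, (A.form _).reparam p hp h hh x]
  rfl

/-- The inhomogeneous term of `A` is the derivative of `γ` at fixed angle and that of `Φ` is
`γ⁻¹∂γ`, here multiplied by `dθ`. By `LoopGroup.maurerCartan_eval` they add up to the full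
Maurer-Cartan form, which is what dictates the transformation law of a Higgs field. -/
theorem higgsConnection_smul {γ : Euc n → LoopGroup E G} (hγ : IsPlot γ) (hc : IsPlot c)
    (x : Euc n) :
    higgsConnection A Φ (fun y => MulOpposite.op (γ y) • p y) (hπ.isPlot_smul hp hγ) c x =
      (Ad ((γ x).1 (c x))⁻¹ : E →L[ℝ] E).comp (higgsConnection A Φ p hp c x) +
        maurerCartan (fun y => (γ y).1 (c y)) x := by
  ext v
  simp only [higgsConnection, add_apply, ContinuousLinearMap.comp_apply,
    ContinuousLinearMap.smulRight_apply, A.toLin_onPlot_smul (c x) hp hγ, Φ.equivariant,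
    LoopGroup.maurerCartan_eval hγ hc, map_add, map_smul, smul_add]
  abel

variable [DiffeologicalSpace G]

/-- Equality in the quotient gives a loop at each point with no smoothness in the parameter. The
bundle axiom `exists_div` gives a smooth family relating the `P`-components, and freeness shows that
it is the same one. -/
theorem exists_loop_of_caloronMk_eq (hπ : IsPrincipalBundle (LoopGroup E G) π)
    {q q' : Euc n → P × G × Real.Angle} (hq : IsPlot q) (hq' : IsPlot q')
    (h : ∀ x, caloronMk E G P (q x) = caloronMk E G P (q' x)) :
    ∃ γ : Euc n → LoopGroup E G, IsPlot γ ∧ q' = fun x =>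
      (MulOpposite.op (γ x) • (q x).1, ((γ x).1 (q x).2.2)⁻¹ * (q x).2.1, (q x).2.2) := by
  have h' (x : Euc n) : ∃ δ : LoopGroup E G, q' x =
      (MulOpposite.op δ • (q x).1, (δ.1 (q x).2.2)⁻¹ * (q x).2.1, (q x).2.2) :=
    Quotient.exact (h x)
  choose δ hδ using h'
  obtain ⟨γ, hγ, hγq⟩ := hπ.exists_div (fun x => (q x).1) (fun x => (q' x).1) hq.1 hq'.1
    fun x => by rw [hδ x, hπ.proj_smul]
  refine ⟨γ, hγ, funext fun x => ?_⟩
  have e : δ x = γ x := by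
    have h1 : MulOpposite.op (δ x) • (q x).1 = MulOpposite.op (γ x) • (q x).1 := by
      rw [← hγq x, hδ x]
    have h2 : MulOpposite.op (δ x * (γ x)⁻¹) • (q x).1 = (q x).1 := by
      rw [MulOpposite.op_mul, mul_smul, h1, smul_smul, ← MulOpposite.op_mul, mul_inv_cancel,
        MulOpposite.op_one, one_smul]
    exact mul_inv_eq_one.1 (hπ.free _ _ h2)
  rw [hδ x, e]

variable [IsContMDiffCompatible E G]

/-- The form `ad(g⁻¹) A(θ) + Θ + ad(g⁻¹) Φ dθ` on `P × G × S¹`. -/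
noncomputable def caloronPreconnection : DForm (P × G × Real.Angle) 1 E where
  onPlot q hq x := toLin.symm ((Ad (q x).2.1⁻¹ : E →L[ℝ] E).comp
    (higgsConnection A Φ (fun y => (q y).1) hq.1 (fun y => (q y).2.2) x) +
      maurerCartan (fun y => (q y).2.1) x)
  smooth q hq := by
    have hg := IsContMDiffCompatible.isPlot_iff_contMDiff (E := E).1 hq.2.1
    exact toLin.symm.contDiff.comp (((contDiff_Ad hg.inv).clm_comp
      (contDiff_higgsConnection A Φ hq.1 hq.2.2)).add (contDiff_maurerCartan hg))
  reparam q hq h hh x := by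
    have hg := IsContMDiffCompatible.isPlot_iff_contMDiff (E := E).1 hq.2.1
    have e1 := higgsConnection_comp A Φ hq.1 hq.2.2 hh x
    have e2 := maurerCartan_comp hg.contMDiffAt hh.contDiffAt (x := x)
    ext v
    rw [toLin_symm_apply, ContinuousAlternatingMap.compContinuousLinearMap_apply, toLin_symm_apply]
    exact congrArg₂ (· + ·) (congrArg _ (DFunLike.congr_fun e1 (v 0))) (DFunLike.congr_fun e2 (v 0))

/-- The form on `P × G × S¹` agrees on plots with equal image in the quotient. Passing to `(pγ,
γ(θ)⁻¹g, θ)` adds `Ad(g⁻¹γ)(γ⁻¹dγ)` through `higgsConnection_smul`, and the Maurer-Cartan form of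
`γ⁻¹g` adds its negative. -/
theorem exists_isCaloronConnection :
    ∃ At : DForm (CaloronTransform E G P) 1 E, IsCaloronConnection A Φ At := by
  obtain ⟨At, hAt⟩ := (caloronPreconnection A Φ).exists_pullback_eq
    (dSmooth_caloronMk (E := E) (G := G) (P := P)) (fun r hr x => hr x) (by
      intro n q q' hq hq' h x
      obtain ⟨γ, hγ, rfl⟩ := exists_loop_of_caloronMk_eq hπ hq hq' h
      have hg := IsContMDiffCompatible.isPlot_iff_contMDiff (E := E).1 hq.2.1
      have hγc := LoopGroup.contMDiff_eval hγ hq.2.2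
      refine congrArg toLin.symm ?_
      ext v
      have e1 := DFunLike.congr_fun (higgsConnection_smul A Φ hq.1 hγ hq.2.2 x) v
      have e2 := DFunLike.congr_fun (maurerCartan_mul (hγc.inv x) (hg x)) v
      simp only [add_apply, ContinuousLinearMap.comp_apply] at e1 e2 ⊢
      rw [e1, e2, maurerCartan_inv (hγc x), mul_inv_rev, inv_inv, Ad_mul]
      simp only [ContinuousLinearMap.comp_apply, map_add, map_neg, Ad_apply_Ad_inv]
      abel)
  refine ⟨At, fun n p g c hp hg hc x v => ?_⟩
  rw [hAt]
  refine (toLin_symm_apply _ _).trans ?_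
  simp only [add_apply, ContinuousLinearMap.comp_apply,
    higgsConnection, ContinuousLinearMap.smulRight_apply, map_add, map_smul, toLin_apply]
  abel

theorem isCaloronConnection_caloronConnection :
    IsCaloronConnection A Φ (caloronConnection A Φ : DForm (CaloronTransform E G P) 1 E) := by
  have h := exists_isCaloronConnection (G := G) (P := P) A Φ
  rw [caloronConnection, dif_pos h]
  exact h.choose_spec

variable [FiniteDimensional ℝ E]

/-- Upstairs the connection is the gauge transform of `higgsConnection` by `g`, so
`linCurvature_gauge` applies. -/
theorem curvature_caloron_apply {At : DForm (CaloronTransform E G P) 1 E}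
    (hAt : IsCaloronConnection A Φ At) {q : Euc n → P × G × Real.Angle} (hq : IsPlot q)
    (x : Euc n) (v : Fin 2 → Euc n) :
    ((curvature G At).pullback (caloronMk E G P) dSmooth_caloronMk).onPlot q hq x v =
      Ad (q x).2.1⁻¹ (linCurvature G
        (higgsConnection A Φ (fun y => (q y).1) hq.1 fun y => (q y).2.2) x (v 0) (v 1)) := by
  have hg := IsContMDiffCompatible.isPlot_iff_contMDiff (E := E).1 hq.2.1
  rw [← curvature_pullback, curvature_onPlot_apply, ← linCurvature_gauge
    ((contDiff_higgsConnection A Φ hq.1 hq.2.2).differentiable (by simp) x) hg]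
  congr 1
  funext y
  ext w
  rw [toLin_apply]
  refine (hAt n _ _ _ hq.1 hq.2.1 hq.2.2 y w).trans ?_
  simp only [higgsConnection, add_apply, ContinuousLinearMap.comp_apply,
    ContinuousLinearMap.smulRight_apply, map_add, map_smul, toLin_apply]
  abel

/-- Invariance of `f` removes `Ad(g⁻¹)`, so the right-hand side no longer involves the `G`-component
of `q`. The factor `2 ^ k` is the product of the factorials of the degrees of the `k` two-forms. -/
theorem polyCurvature_caloron_apply {At : DForm (CaloronTransform E G P) 1 E}
    (hAt : IsCaloronConnection A Φ At) {k : ℕ} (f : InvariantPolynomial E G k)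
    {q : Euc n → P × G × Real.Angle} (hq : IsPlot q) (x : Euc n) (v : Fin (2 * k) → Euc n) :
    ((polyCurvature f (curvature G At)).pullback (caloronMk E G P) dSmooth_caloronMk).onPlot q hq x
        v = ((2 : ℝ) ^ k)⁻¹ * ∑ σ : Equiv.Perm (Fin (2 * k)),
      Equiv.Perm.sign σ • f.toMultilinear fun i => linCurvature G
        (higgsConnection A Φ (fun y => (q y).1) hq.1 fun y => (q y).2.2) x
        (v (σ (finCongr (by simp [mul_comm]) (finSigmaFinEquiv (n := fun _ : Fin k => 2) ⟨i, 0⟩))))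
        (v (σ (finCongr (by simp [mul_comm])
          (finSigmaFinEquiv (n := fun _ : Fin k => 2) ⟨i, 1⟩)))) := by
  rw [← polyCurvature_pullback, polyCurvature, DForm.wedge, wedgeAlt_apply]
  simp only [curvature_caloron_apply A Φ hAt hq, f.invariant]
  simp

theorem exists_caloronProj_pullback_eq {At : DForm (CaloronTransform E G P) 1 E}
    (hAt : IsCaloronConnection A Φ At) {k : ℕ} (f : InvariantPolynomial E G k) :
    ∃ b : DForm (M × Real.Angle) (2 * k) ℝ,
      b.pullback (caloronProj hπ) (dSmooth_caloronProj hπ) =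
        polyCurvature f (curvature G At) := by
  have hlift : HasLocalLifts (caloronProj hπ ∘ caloronMk E G P) := by
    intro n r hr x
    obtain ⟨q, hq, hqr⟩ := hπ.exists_lift (fun y => (r y).1) hr.1 x
    refine ⟨fun y => (q y, 1, (r y).2), ⟨hq, isPlot_const, hr.2⟩, ?_⟩
    filter_upwards [hqr] with y hy
    exact Prod.ext hy rfl
  have hsm : DSmooth (caloronProj hπ ∘ caloronMk E G P) := fun n p hp =>
    (hp.dSmooth_comp dSmooth_caloronMk).dSmooth_comp (dSmooth_caloronProj hπ)
  obtain ⟨b, hb⟩ := ((polyCurvature f (curvature G At)).pullback (caloronMk E G P)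
    dSmooth_caloronMk).exists_pullback_eq hsm hlift (by
      intro n q q' hq hq' h x
      obtain ⟨γ, hγ, hγq⟩ := hπ.exists_div (fun x => (q x).1) (fun x => (q' x).1) hq.1 hq'.1
        fun x => congrArg Prod.fst (h x)
      have hγc := LoopGroup.contMDiff_eval hγ hq.2.2
      have hg := IsContMDiffCompatible.isPlot_iff_contMDiff (E := E).1 hq.2.1
      -- This plot has the same image as `q` in the caloron transform and the same components as
      -- `q'` in `P` and `S¹`. It differs from `q'` only in `G`, which the form does not see.
      let q₁ : Euc n → P × G × Real.Angle := fun x =>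
        ((q' x).1, ((γ x).1 (q x).2.2)⁻¹ * (q x).2.1, (q' x).2.2)
      have hq₁ : IsPlot q₁ := ⟨hq'.1,
        IsContMDiffCompatible.isPlot_iff_contMDiff (E := E).2 (hγc.inv.mul hg), hq'.2.2⟩
      have e1 : ((polyCurvature f (curvature G At)).pullback (caloronMk E G P)
          dSmooth_caloronMk).onPlot q hq x = ((polyCurvature f (curvature G At)).pullback
          (caloronMk E G P) dSmooth_caloronMk).onPlot q₁ hq₁ x := by
        refine congrFun ((polyCurvature f (curvature G At)).congr_plot (funext fun y => ?_) _ _) x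
        refine Quotient.sound (s := caloronSetoid E G P) (a := q y) (b := q₁ y) ⟨γ y, ?_⟩
        exact Prod.ext (hγq y) (Prod.ext rfl (congrArg Prod.snd (h y)).symm)
      rw [e1]
      ext v
      rw [polyCurvature_caloron_apply A Φ hAt, polyCurvature_caloron_apply A Φ hAt])
  -- The form `b` was obtained by descent from `P × G × S¹` in one go. Injectivity of pullback along
  -- the quotient map gives the identity on the caloron transform itself.
  refine ⟨b, DForm.pullback_injective dSmooth_caloronMk (fun r hr x => hr x) ?_⟩
  exact hb

theorem caloronChernWeil_pullback {k : ℕ} (f : InvariantPolynomial E G k) :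
    (caloronChernWeil f A Φ).pullback (caloronProj hπ) (dSmooth_caloronProj hπ) =
      polyCurvature f (curvature G (caloronConnection A Φ)) :=
  DForm.pullback_descend _ (exists_caloronProj_pullback_eq A Φ
    (isCaloronConnection_caloronConnection A Φ) f)

end CaloronConnection

/-! ### Combinatorics of contracting `f(C, …, C)` with one vector. -/

section Contraction

/-- The even positions in `Fin (2 * k + 2)`. -/
def evenPos {k : ℕ} (i : Fin (k + 1)) : Fin (2 * k + 1 + 1) := ⟨2 * i, by omega⟩

/-- The odd positions in `Fin (2 * k + 2)`. -/
def oddPos {k : ℕ} (i : Fin (k + 1)) : Fin (2 * k + 1 + 1) := ⟨2 * i + 1, by omega⟩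

theorem evenPos_injective {k : ℕ} : Function.Injective (evenPos (k := k)) := fun i j h => by
  have := congrArg Fin.val h
  simp only [evenPos] at this
  omega

theorem oddPos_injective {k : ℕ} : Function.Injective (oddPos (k := k)) := fun i j h => by
  have := congrArg Fin.val h
  simp only [oddPos] at this
  omega

theorem evenPos_ne_oddPos {k : ℕ} (i j : Fin (k + 1)) : evenPos i ≠ oddPos j := fun h => by
  have := congrArg Fin.val h
  simp only [evenPos, oddPos] at this
  omega

variable {D E : Type*} [NormedAddCommGroup E] [NormedSpace ℝ E] {k : ℕ}

/-- The summands of `f(C, …, C)` for a skew-symmetric function `C` of two vectors. -/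
noncomputable def pairTerm (f : ContinuousMultilinearMap ℝ (fun _ : Fin (k + 1) => E) ℝ)
    (C : D → D → E) (V : Fin (2 * k + 1 + 1) → D) (σ : Equiv.Perm (Fin (2 * k + 1 + 1))) : ℝ :=
  Equiv.Perm.sign σ • f fun i => C (V (σ (evenPos i))) (V (σ (oddPos i)))

variable (f : ContinuousMultilinearMap ℝ (fun _ : Fin (k + 1) => E) ℝ)
    {C : D → D → E} (hC : ∀ v w, C v w = - C w v) (V : Fin (2 * k + 1 + 1) → D)

theorem map_update_neg_self (X : Fin (k + 1) → E) (i : Fin (k + 1)) :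
    f (Function.update X i (-X i)) = - f X := by
  have h := f.toMultilinearMap.map_update_neg X i (X i)
  rwa [Function.update_eq_self] at h

-- Swapping the two entries of one pair costs a sign in `sign σ` and another by skew-symmetry of
-- `C`.
include hC in
theorem pairTerm_mul_swap (σ : Equiv.Perm (Fin (2 * k + 1 + 1))) (i : Fin (k + 1)) :
    pairTerm f C V (σ * Equiv.swap (evenPos i) (oddPos i)) = pairTerm f C V σ := by
  set X : Fin (k + 1) → E := fun j => C (V (σ (evenPos j))) (V (σ (oddPos j))) with hX
  have h : (fun j => C (V ((σ * Equiv.swap (evenPos i) (oddPos i)) (evenPos j)))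
      (V ((σ * Equiv.swap (evenPos i) (oddPos i)) (oddPos j)))) = Function.update X i (-X i) := by
    funext j
    by_cases hj : j = i
    · subst hj
      rw [Function.update_self]
      simp only [Equiv.Perm.mul_apply, Equiv.swap_apply_left, Equiv.swap_apply_right, hX]
      exact hC _ _
    · rw [Function.update_of_ne hj]
      simp only [Equiv.Perm.mul_apply]
      rw [Equiv.swap_apply_of_ne_of_ne (evenPos_injective.ne hj) (evenPos_ne_oddPos j i),
        Equiv.swap_apply_of_ne_of_ne (evenPos_ne_oddPos i j).symm (oddPos_injective.ne hj)]
  rw [pairTerm, h, map_update_neg_self, Equiv.Perm.sign_mul,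
    Equiv.Perm.sign_swap (evenPos_ne_oddPos i i), pairTerm]
  simp [hX]

/-- Exchanging two whole pairs is a product of two transpositions, hence even, and `f` is symmetric.
-/
theorem pairTerm_mul_swap_pairs
    (hf : ∀ (σ : Equiv.Perm (Fin (k + 1))) (v : Fin (k + 1) → E), f (fun i => v (σ i)) = f v)
    (σ : Equiv.Perm (Fin (2 * k + 1 + 1))) (i j : Fin (k + 1)) :
    pairTerm f C V (σ * (Equiv.swap (evenPos i) (evenPos j) * Equiv.swap (oddPos i) (oddPos j))) =
      pairTerm f C V σ := by
  by_cases hij : i = j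
  · subst hij
    rw [Equiv.swap_self, Equiv.swap_self, ← Equiv.Perm.one_def, mul_one, mul_one]
  rw [pairTerm, Equiv.Perm.sign_mul, Equiv.Perm.sign_mul,
    Equiv.Perm.sign_swap (evenPos_injective.ne hij), Equiv.Perm.sign_swap (oddPos_injective.ne hij),
    pairTerm, ← hf (Equiv.swap i j)]
  have he (l : Fin (k + 1)) : (Equiv.swap (evenPos i) (evenPos j) *
      Equiv.swap (oddPos i) (oddPos j)) (evenPos l) = evenPos (Equiv.swap i j l) := by
    rw [Equiv.Perm.mul_apply, Equiv.swap_apply_of_ne_of_ne (evenPos_ne_oddPos _ _)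
      (evenPos_ne_oddPos _ _), evenPos_injective.swap_apply]
  have ho (l : Fin (k + 1)) : (Equiv.swap (evenPos i) (evenPos j) *
      Equiv.swap (oddPos i) (oddPos j)) (oddPos l) = oddPos (Equiv.swap i j l) := by
    rw [Equiv.Perm.mul_apply, oddPos_injective.swap_apply, Equiv.swap_apply_of_ne_of_ne
      (evenPos_ne_oddPos _ _).symm (evenPos_ne_oddPos _ _).symm]
  simp only [Equiv.Perm.mul_apply (σ), he, ho]
  simp

include hC in
/-- A permutation moving the position `0` to a given one and preserving the summands. -/
theorem exists_perm_pairTerm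
    (hf : ∀ (σ : Equiv.Perm (Fin (k + 1))) (v : Fin (k + 1) → E), f (fun i => v (σ i)) = f v)
    (j : Fin (2 * k + 1 + 1)) : ∃ ρ : Equiv.Perm (Fin (2 * k + 1 + 1)), ρ 0 = j ∧
      ∀ σ, pairTerm f C V (σ * ρ) = pairTerm f C V σ := by
  let i : Fin (k + 1) := ⟨j / 2, by omega⟩
  let ρ := Equiv.swap (evenPos 0) (evenPos i) * Equiv.swap (oddPos 0) (oddPos i)
  have h0 : (0 : Fin (2 * k + 1 + 1)) = evenPos 0 := rfl
  have hρ : ρ 0 = evenPos i := by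
    rw [h0, Equiv.Perm.mul_apply, Equiv.swap_apply_of_ne_of_ne (evenPos_ne_oddPos _ _)
      (evenPos_ne_oddPos _ _), Equiv.swap_apply_left]
  rcases Nat.mod_two_eq_zero_or_one j with hj | hj
  · refine ⟨ρ, ?_, fun σ => pairTerm_mul_swap_pairs f V hf σ 0 i⟩
    rw [hρ]
    ext
    simp only [evenPos, i]
    omega
  · refine ⟨Equiv.swap (evenPos i) (oddPos i) * ρ, ?_, fun σ => ?_⟩
    · rw [Equiv.Perm.mul_apply, hρ, Equiv.swap_apply_left]
      ext
      simp only [oddPos, i]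
      omega
    · rw [← mul_assoc, pairTerm_mul_swap_pairs f V hf, pairTerm_mul_swap f hC]

-- Sort the permutations by the position `j` that they send to `0`. Multiplying by the `ρ` of
-- `exists_perm_pairTerm` moves that position to the front without changing the summand, so the `2k
-- + 2` classes contribute equally. The class fixing `0` is parametrised by `decomposeFin`.
include hC in
theorem sum_pairTerm
    (hf : ∀ (σ : Equiv.Perm (Fin (k + 1))) (v : Fin (k + 1) → E), f (fun i => v (σ i)) = f v) :
    ∑ σ, pairTerm f C V σ = (2 * (k + 1) : ℝ) *
      ∑ τ : Equiv.Perm (Fin (2 * k + 1)), pairTerm f C V (Equiv.Perm.decomposeFin.symm (0, τ)) := by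
  choose ρ hρ hT using exists_perm_pairTerm f hC V hf
  have h1 (σ : Equiv.Perm (Fin (2 * k + 1 + 1))) : pairTerm f C V σ =
      ∑ j, if σ j = 0 then pairTerm f C V σ else 0 := by
    have h (j : Fin (2 * k + 1 + 1)) : (σ j = 0) = (j = σ.symm 0) := by
      rw [Equiv.eq_symm_apply]
    simp only [h, Finset.sum_ite_eq', Finset.mem_univ, if_true]
  have h2 (j : Fin (2 * k + 1 + 1)) : (∑ σ, if σ j = 0 then pairTerm f C V σ else 0) =
      ∑ σ : Equiv.Perm (Fin (2 * k + 1 + 1)), if σ 0 = 0 then pairTerm f C V σ else 0 := by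
    refine (Fintype.sum_equiv (Equiv.mulRight (ρ j)) _ _ fun σ => ?_)
    simp only [Equiv.coe_mulRight, Equiv.Perm.mul_apply, hρ, hT]
  have h3 : (∑ σ : Equiv.Perm (Fin (2 * k + 1 + 1)), if σ 0 = 0 then pairTerm f C V σ else 0) =
      ∑ τ : Equiv.Perm (Fin (2 * k + 1)),
        pairTerm f C V (Equiv.Perm.decomposeFin.symm (0, τ)) := by
    rw [← Equiv.sum_comp Equiv.Perm.decomposeFin.symm, Fintype.sum_prod_type,
      Fintype.sum_eq_single 0]
    · simp
    · intro p hp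
      simp [hp]
  rw [Finset.sum_congr rfl fun σ _ => h1 σ, Finset.sum_comm, Finset.sum_congr rfl fun j _ => h2 j,
    h3, Finset.sum_const, Finset.card_univ, Fintype.card_fin, nsmul_eq_mul]
  push_cast
  ring

include hC in
/-- The contraction of `f(C, …, C)` with a vector in the last slot. -/
theorem sum_pairTerm_snoc
    (hf : ∀ (σ : Equiv.Perm (Fin (k + 1))) (v : Fin (k + 1) → E), f (fun i => v (σ i)) = f v)
    (v : Fin (2 * k + 1) → D) (e : D) :
    ∑ σ, pairTerm f C (Fin.snoc (α := fun _ => D) v e) σ = (2 * (k + 1) : ℝ) *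
      ∑ τ : Equiv.Perm (Fin (2 * k + 1)), Equiv.Perm.sign τ •
        f (Fin.cons (C (v (τ 0)) e) fun i : Fin k =>
          C (v (τ ⟨2 * i + 1, by omega⟩)) (v (τ ⟨2 * i + 2, by omega⟩))) := by
  -- The vector `e` is rotated from the last slot to slot `0`, where `sum_pairTerm` singles it out.
  let W : Fin (2 * k + 1 + 1) → D := Fin.cons e v
  have hW (i : Fin (2 * k + 1 + 1)) :
      Fin.snoc (α := fun _ => D) v e i = W (finRotate _ i) := by
    refine Fin.lastCases ?_ (fun i => ?_) i
    · rw [Fin.snoc_last, finRotate_last]; rfl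
    · rw [Fin.snoc_castSucc, finRotate_of_lt (by simpa using i.is_le)]; rfl
  -- A rotation of `2k + 2` slots is odd. This sign cancels against the one in `h2`, which comes
  -- from moving `e` from the first to the second argument of `C`.
  have h1 (σ : Equiv.Perm (Fin (2 * k + 1 + 1))) :
      pairTerm f C (Fin.snoc (α := fun _ => D) v e) σ = - pairTerm f C W (finRotate _ * σ) := by
    simp only [pairTerm, hW, Equiv.Perm.sign_mul, sign_finRotate, Equiv.Perm.mul_apply]
    simp [pow_succ, pow_mul]
  have h2 (τ : Equiv.Perm (Fin (2 * k + 1))) :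
      pairTerm f C W (Equiv.Perm.decomposeFin.symm (0, τ)) = - (Equiv.Perm.sign τ •
        f (Fin.cons (C (v (τ 0)) e) fun i : Fin k =>
          C (v (τ ⟨2 * i + 1, by omega⟩)) (v (τ ⟨2 * i + 2, by omega⟩)))) := by
    set X : Fin (k + 1) → E := Fin.cons (C (v (τ 0)) e) fun i : Fin k =>
      C (v (τ ⟨2 * i + 1, by omega⟩)) (v (τ ⟨2 * i + 2, by omega⟩)) with hX
    have hs (l : Fin (2 * k + 1)) :
        W (Equiv.Perm.decomposeFin.symm (0, τ) l.succ) = v (τ l) := by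
      rw [Equiv.Perm.decomposeFin_symm_apply_succ]
      simp [W]
    have h : (fun i => C (W (Equiv.Perm.decomposeFin.symm (0, τ) (evenPos i)))
        (W (Equiv.Perm.decomposeFin.symm (0, τ) (oddPos i)))) = Function.update X 0 (-X 0) := by
      funext i
      refine Fin.cases ?_ (fun i => ?_) i
      · rw [Function.update_self]
        have e1 : (oddPos 0 : Fin (2 * k + 1 + 1)) = (0 : Fin (2 * k + 1)).succ := rfl
        have e2 : (evenPos 0 : Fin (2 * k + 1 + 1)) = 0 := rfl
        rw [e1, hs, e2, Equiv.Perm.decomposeFin_symm_apply_zero]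
        exact hC _ _
      · rw [Function.update_of_ne (Fin.succ_ne_zero i)]
        have e1 : evenPos i.succ = (⟨2 * i + 1, by omega⟩ : Fin (2 * k + 1)).succ := by
          ext; simp [evenPos]; ring
        have e2 : oddPos i.succ = (⟨2 * i + 2, by omega⟩ : Fin (2 * k + 1)).succ := by
          ext; simp [oddPos]; ring
        rw [e1, e2, hs, hs]
        rfl
    rw [pairTerm, h, map_update_neg_self,
      Equiv.Perm.decomposeFin.symm_sign]
    simp
  rw [Finset.sum_congr rfl fun σ _ => h1 σ, Finset.sum_neg_distrib,
    show (∑ σ, pairTerm f C W (finRotate _ * σ)) = ∑ σ, pairTerm f C W σ from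
      Equiv.sum_comp (Equiv.mulLeft (finRotate (2 * k + 1 + 1))) (pairTerm f C W),
    sum_pairTerm f hC W hf, Finset.sum_congr rfl fun τ _ => h2 τ, Finset.sum_neg_distrib]
  ring

end Contraction

/-! ### The curvature of `A(θ) + Φ dθ`, and fibre integration. -/

section StringForm

variable {E G P M : Type*} [NormedAddCommGroup E] [NormedSpace ℝ E]
  [TopologicalSpace G] [ChartedSpace E G] [Group G] [LieGroup 𝓘(ℝ, E) ∞ G]
  [DiffeologicalSpace P] [DiffeologicalSpace M]
  [MulAction (LoopGroup E G)ᵐᵒᵖ P] {π : P → M} {hπ : IsPrincipalBundle (LoopGroup E G) π}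

theorem linCurvature_swap {D : Type*} [NormedAddCommGroup D] [NormedSpace ℝ D]
    (α : D → D →L[ℝ] E) (x v w : D) : linCurvature G α x v w = - linCurvature G α x w v := by
  rw [linCurvature, linCurvature, lieBr_swap]
  abel

theorem initEuc_inclEuc (n : ℕ) (v : Euc n) : initEuc n (inclEuc n v) = v := by
  simpa using initEuc_incl_add n v 0

theorem lastCoord_inclEuc (n : ℕ) (v : Euc n) : lastCoord n (inclEuc n v) = 0 := by
  simpa using lastCoord_incl_add n v 0

theorem initEuc_lastEuc (n : ℕ) : initEuc n (lastEuc n) = 0 := by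
  simpa using initEuc_incl_add n 0 1

theorem lastCoord_lastEuc (n : ℕ) : lastCoord n (lastEuc n) = 1 := by
  simpa using lastCoord_incl_add n 0 1

variable (A : LoopConnection hπ) (Φ : HiggsField hπ) {n : ℕ} {p : Euc n → P} (hp : IsPlot p)

theorem higgsConnection_cylinder (y : Euc (n + 1)) :
    higgsConnection A Φ (p ∘ initEuc n) (isPlot_reparam hp (initEuc n).contDiff)
      (fun y => (lastCoord n y : Real.Angle)) y =
      (toLin ((A.form (lastCoord n y : Real.Angle)).onPlot p hp (initEuc n y))).comp (initEuc n) +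
        (lastCoord n).smulRight (Φ.toFun (p (initEuc n y)) (lastCoord n y : Real.Angle)) := by
  have hd : dTheta (fun y => (lastCoord n y : Real.Angle)) y = lastCoord n :=
    (dTheta_eq_fderiv (s := fun y => lastCoord n y) (lastCoord n).continuous.continuousAt
      (Eventually.of_forall fun _ => rfl)).trans (lastCoord n).fderiv
  rw [higgsConnection, hd]
  ext v
  rw [(A.form _).reparam p hp _ (initEuc n).contDiff, (initEuc n).fderiv]
  rfl

theorem hasFDerivAt_comp_inclEuc {F : Type*} [NormedAddCommGroup F] [NormedSpace ℝ F]
    {φ : Euc n × ℝ → F} (hφ : Differentiable ℝ φ) (x : Euc n) (t : ℝ) :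
    (∀ v, fderiv ℝ φ (x, t) (v, 0) = fderiv ℝ (fun x => φ (x, t)) x v) ∧
      fderiv ℝ φ (x, t) (0, 1) = deriv (fun s : ℝ => φ (x, t + s)) 0 := by
  have h := (hφ (x, t)).hasFDerivAt
  have h1 : HasFDerivAt (fun x => φ (x, t)) _ x :=
    h.comp x ((hasFDerivAt_id (𝕜 := ℝ) x).prodMk (hasFDerivAt_const t x))
  have h2 : HasDerivAt (fun s : ℝ => (x, t + s)) ((0 : Euc n), (1 : ℝ)) 0 :=
    (hasDerivAt_const (0 : ℝ) x).prodMk ((hasDerivAt_id (0 : ℝ)).const_add t)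
  have h3 := (hφ (x, t + 0)).hasFDerivAt.comp_hasDerivAt 0 h2
  refine ⟨fun v => ?_, ?_⟩
  · rw [h1.fderiv]; simp
  · rw [add_zero] at h3
    exact h3.deriv.symm

variable [FiniteDimensional ℝ E]

theorem toLin_nablaHiggs (x : Euc n) (t : ℝ) (v : Euc n) :
    toLin ((nablaHiggs A Φ (t : Real.Angle)).onPlot p hp x) v =
      fderiv ℝ (fun y => Φ.toFun (p y) (t : Real.Angle)) x v +
        lieBr E G (toLin ((A.form (t : Real.Angle)).onPlot p hp x) v)
          (Φ.toFun (p x) (t : Real.Angle)) -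
        deriv (fun s : ℝ => toLin ((A.form ((t + s : ℝ) : Real.Angle)).onPlot p hp x)) 0 v := by
  have h : (nablaHiggs A Φ (t : Real.Angle)).onPlot p hp x (fun _ => v) =
      extDeriv (fun y => ContinuousAlternatingMap.constOfIsEmpty ℝ (Euc n) (Fin 0)
        (Φ.toFun (p y) (t : Real.Angle))) x (fun _ => v) +
      (DForm.wedge₂ (lieBrMultilinear E G) (A.form (t : Real.Angle))
        (Φ.atAngle (t : Real.Angle))).onPlot p hp x (fun _ => v) +
      (-1 : ℝ) • deriv (fun s : ℝ => (A.form ((t : Real.Angle) + (s : Real.Angle))).onPlot p hp x) 0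
        (fun _ => v) := rfl
  have hA : ContDiff ℝ ∞ fun s : ℝ => (A.form ((t + s : ℝ) : Real.Angle)).onPlot p hp x :=
    (A.smooth n p hp).comp (contDiff_const.prodMk (contDiff_const.add contDiff_id))
  have hd : HasDerivAt
      (fun s : ℝ => toLin ((A.form ((t + s : ℝ) : Real.Angle)).onPlot p hp x)) _ 0 :=
    (toLin (D := Euc n) (V := E)).toContinuousLinearEquiv.hasFDerivAt.comp_hasDerivAt 0
      (hA.differentiable (by simp) 0).hasDerivAt
  rw [toLin_apply, h, extDeriv_constOfIsEmpty, wedge₂_lieBr_one_zero, hd.deriv]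
  simp only [← Real.Angle.coe_add, neg_smul, one_smul, ← sub_eq_add_neg]
  rfl

/-- The curvature of `A(θ) + Φ dθ` on `P × S¹`: its restriction to `P` is the curvature of `A(θ)`,
and its contraction with `∂/∂θ` is `∇Φ`. -/
theorem linCurvature_cylinder (x : Euc n) (t : ℝ) :
    let C := linCurvature G (higgsConnection A Φ (p ∘ initEuc n)
      (isPlot_reparam hp (initEuc n).contDiff) (fun y => (lastCoord n y : Real.Angle)))
      (inclEuc n x + t • lastEuc n)
    (∀ v w, C (inclEuc n v) (inclEuc n w) =
      linCurvature G (fun y => toLin ((A.form (t : Real.Angle)).onPlot p hp y)) x v w) ∧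
    ∀ v, C (inclEuc n v) (lastEuc n) =
      toLin ((nablaHiggs A Φ (t : Real.Angle)).onPlot p hp x) v := by
  intro C
  -- Passing to `ℝⁿ × ℝ` through `κ` separates the derivatives in `x` from those in `t`, for the
  -- `A`-part `α` and the `Φ`-part `ψ`.
  let α : Euc n × ℝ → Euc n →L[ℝ] E := fun z =>
    toLin ((A.form (z.2 : Real.Angle)).onPlot p hp z.1)
  let ψ : Euc n × ℝ → E := fun z => Φ.toFun (p z.1) (z.2 : Real.Angle)
  let κ : Euc (n + 1) →L[ℝ] Euc n × ℝ := (initEuc n).prod (lastCoord n)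
  have hα : Differentiable ℝ α :=
    ((toLin (D := Euc n) (V := E)).contDiff.comp (A.smooth n p hp)).differentiable (by simp)
  have hψ : Differentiable ℝ ψ := (Φ.smooth p hp).differentiable (by simp)
  have hH : higgsConnection A Φ (p ∘ initEuc n) (isPlot_reparam hp (initEuc n).contDiff)
      (fun y => (lastCoord n y : Real.Angle)) =
      fun y => (α (κ y)).comp (initEuc n) + (lastCoord n).smulRight (ψ (κ y)) :=
    funext fun y => higgsConnection_cylinder A Φ hp y
  have hκ : κ (inclEuc n x + t • lastEuc n) = (x, t) :=
    Prod.ext (initEuc_incl_add n x t) (lastCoord_incl_add n x t)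
  have hκv (v : Euc n) : κ (inclEuc n v) = (v, 0) :=
    Prod.ext (initEuc_inclEuc n v) (lastCoord_inclEuc n v)
  have hκe : κ (lastEuc n) = (0, 1) := Prod.ext (initEuc_lastEuc n) (lastCoord_lastEuc n)
  have dα : HasFDerivAt (fun y => α (κ y)) ((fderiv ℝ α (x, t)).comp κ)
      (inclEuc n x + t • lastEuc n) := by
    have := (hα (κ (inclEuc n x + t • lastEuc n))).hasFDerivAt.comp _ κ.hasFDerivAt
    rwa [hκ] at this
  have dψ : HasFDerivAt (fun y => ψ (κ y)) ((fderiv ℝ ψ (x, t)).comp κ)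
      (inclEuc n x + t • lastEuc n) := by
    have := (hψ (κ (inclEuc n x + t • lastEuc n))).hasFDerivAt.comp _ κ.hasFDerivAt
    rwa [hκ] at this
  have dH (u w : Euc (n + 1)) :
      fderiv ℝ (fun y => (α (κ y)).comp (initEuc n) + (lastCoord n).smulRight (ψ (κ y)))
        (inclEuc n x + t • lastEuc n) u w =
      fderiv ℝ α (x, t) (κ u) (initEuc n w) + lastCoord n w • fderiv ℝ ψ (x, t) (κ u) := by
    have h : HasFDerivAt
        (fun y => (α (κ y)).comp (initEuc n) + (lastCoord n).smulRight (ψ (κ y))) _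
        (inclEuc n x + t • lastEuc n) := (dα.clm_comp (hasFDerivAt_const (initEuc n) _)).add
      ((ContinuousLinearMap.smulRightL ℝ (Euc (n + 1)) E (lastCoord n)).hasFDerivAt.comp _ dψ)
    rw [h.fderiv]
    simp
  obtain ⟨a1, a2⟩ := hasFDerivAt_comp_inclEuc hα x t
  obtain ⟨b1, b2⟩ := hasFDerivAt_comp_inclEuc hψ x t
  refine ⟨fun v w => ?_, fun v => ?_⟩
  · simp only [C, hH, linCurvature, dH, hκ, hκv, a1, initEuc_inclEuc, lastCoord_inclEuc, zero_smul,
      add_zero, add_apply, ContinuousLinearMap.comp_apply, ContinuousLinearMap.smulRight_apply, α]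
  -- The three terms of `∇Φ` appear separately: `dΦ` from differentiating `ψ` along `v`, `-∂A/∂θ`
  -- from differentiating `α` along `∂/∂t`, and `[A, Φ]` from the bracket.
  · rw [toLin_nablaHiggs]
    simp only [C, hH, linCurvature, dH, hκ, hκv, hκe, a2, b1, initEuc_inclEuc, lastCoord_inclEuc,
      initEuc_lastEuc, lastCoord_lastEuc, zero_smul, one_smul, map_zero, zero_add,
      add_zero, add_apply, ContinuousLinearMap.comp_apply, ContinuousLinearMap.smulRight_apply, α, ψ]
    abel

/-- The factorials of the degrees `1, 2, …, 2` multiply to `2 ^ k`. The leading block has length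
one, so the curvature factor number `i` occupies the slots `2i + 1` and `2i + 2`. -/
theorem higgsCurvatureForm_onPlot_apply {k : ℕ}
    (f : ContinuousMultilinearMap ℝ (fun _ : Fin (k + 1) => E) ℝ) (θ : Real.Angle) (x : Euc n)
    (v : Fin (2 * k + 1) → Euc n) :
    (higgsCurvatureForm f A Φ θ).onPlot p hp x v = ((2 : ℝ) ^ k)⁻¹ *
      ∑ τ : Equiv.Perm (Fin (2 * k + 1)), Equiv.Perm.sign τ •
        f (Fin.cons (toLin ((nablaHiggs A Φ θ).onPlot p hp x) (v (τ 0))) fun i : Fin k =>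
          linCurvature G (fun y => toLin ((A.form θ).onPlot p hp y)) x
            (v (τ ⟨2 * i + 1, by omega⟩)) (v (τ ⟨2 * i + 2, by omega⟩))) := by
  rw [higgsCurvatureForm, DForm.wedgeCons, DForm.wedge, wedgeAlt_apply, smul_eq_mul]
  congr 1
  · simp [Fin.prod_univ_succ]
  refine Finset.sum_congr rfl fun τ _ => congrArg _ (congrArg f (funext fun i => ?_))
  refine Fin.cases ?_ (fun i => ?_) i
  · refine congrArg ((nablaHiggs A Φ θ).onPlot p hp x) (funext fun j : Fin 1 => ?_)
    rw [Fin.fin_one_eq_zero j]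
    refine congrArg v (congrArg τ (Fin.ext ?_))
    rw [finCongr_apply_coe, finSigmaFinEquiv_apply]
    rfl
  · have hval (j : Fin 2) : (finSigmaFinEquiv
        (n := (Fin.cons 1 fun _ => 2 : Fin (k + 1) → ℕ)) ⟨i.succ, j⟩ : ℕ) = 2 * i + 1 + j := by
      rw [finSigmaFinEquiv_apply]
      refine congrArg (· + (j : ℕ)) ((Fin.sum_univ_succ _).trans ?_)
      change 1 + ∑ _ : Fin i, 2 = _
      rw [Finset.sum_const, Finset.card_univ, Fintype.card_fin, smul_eq_mul]
      ring
    refine (curvature_onPlot_apply (G := G) (A.form θ) p hp x _).trans ?_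
    exact congrArg₂ (linCurvature G (fun y => toLin ((A.form θ).onPlot p hp y)) x)
      (congrArg v (congrArg τ (Fin.ext (hval 0)))) (congrArg v (congrArg τ (Fin.ext (hval 1))))

variable [DiffeologicalSpace G] [IsContMDiffCompatible E G]

/-- The asserted formula before integration. The Chern-Weil form is evaluated through a lift to `P ×
G × S¹`, where it is the alternating sum treated by `sum_pairTerm_snoc`, and `linCurvature_cylinder`
identifies the entries. -/
theorem fibreIntegrand_caloronChernWeil {k : ℕ} (f : InvariantPolynomial E G (k + 1)) (x : Euc n)
    (t : ℝ) :
    fibreIntegrand (k := 2 * k + 1) (caloronChernWeil f A Φ) (π ∘ p)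
      (hp.dSmooth_comp hπ.smooth_proj) x t =
      ((k : ℝ) + 1) •
        (higgsCurvatureForm f.toMultilinear A Φ (t : Real.Angle)).onPlot p hp x := by
  -- A lift of the cylinder over `π ∘ p`. The value `1` in `G` is an arbitrary choice.
  let q : Euc (n + 1) → P × G × Real.Angle :=
    fun y => (p (initEuc n y), 1, (lastCoord n y : Real.Angle))
  have hq : IsPlot q := ⟨isPlot_reparam hp (initEuc n).contDiff, isPlot_const, fun x =>
    ⟨fun y => lastCoord n y, (lastCoord n).contDiff.isPlot, Eventually.of_forall fun _ => rfl⟩⟩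
  obtain ⟨c1, c2⟩ := linCurvature_cylinder (G := G) A Φ hp x t
  ext v
  have e1 : fibreIntegrand (k := 2 * k + 1) (caloronChernWeil f A Φ) (π ∘ p)
      (hp.dSmooth_comp hπ.smooth_proj) x t v =
      (((caloronChernWeil f A Φ).pullback (caloronProj hπ) (dSmooth_caloronProj hπ)).pullback
        (caloronMk E G P) dSmooth_caloronMk).onPlot q hq (inclEuc n x + t • lastEuc n)
        (Fin.snoc (α := fun _ => Euc (n + 1)) (inclEuc n ∘ v) (lastEuc n)) := rfl
  rw [e1, caloronChernWeil_pullback]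
  have e2 := sum_pairTerm_snoc f.toMultilinear (linCurvature_swap (G := G)
    (higgsConnection A Φ (p ∘ initEuc n) (isPlot_reparam hp (initEuc n).contDiff)
      (fun y => (lastCoord n y : Real.Angle))) (inclEuc n x + t • lastEuc n)) f.symmetric
    (inclEuc n ∘ v) (lastEuc n)
  simp only [Function.comp_apply, c1, c2] at e2
  -- One of the `k + 1` two-forms has become a one-form. Its normalising `½` cancels the two slots
  -- of its pair, which leaves the `k + 1` pairs that could have received `∂/∂θ`.
  have e3 : ((2 : ℝ) ^ (k + 1))⁻¹ * (2 * (k + 1)) = (k + 1) * (2 ^ k)⁻¹ := by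
    rw [pow_succ]; field_simp
  refine (polyCurvature_caloron_apply A Φ (isCaloronConnection_caloronConnection A Φ) f hq _
    _).trans ((congrArg (((2 : ℝ) ^ (k + 1))⁻¹ * ·) ((Finset.sum_congr rfl fun σ _ => congrArg _
      (congrArg _ (funext fun i => ?_))).trans e2)).trans ?_)
  · refine congrArg₂ _ (congrArg _ (congrArg σ (Fin.ext ?_)))
      (congrArg _ (congrArg σ (Fin.ext ?_)))
    · simp [finSigmaFinEquiv_apply, evenPos, mul_comm]
    · simp [finSigmaFinEquiv_apply, oddPos, mul_comm]
  · refine Eq.trans ?_ (congrArg (((k : ℝ) + 1) * ·)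
      (higgsCurvatureForm_onPlot_apply A Φ hp f.toMultilinear _ x v)).symm
    rw [← mul_assoc, e3, mul_assoc]

/-- Joint smoothness in the point and the angle is already known for the fibre integrand, which is
this loop of forms multiplied by the nonzero constant `k + 1`. -/
theorem smoothLoopOfForms_higgsCurvatureForm {k : ℕ} (f : InvariantPolynomial E G (k + 1)) :
    SmoothLoopOfForms (higgsCurvatureForm f.toMultilinear A Φ) := by
  intro n p hp
  have h := (contDiff_fibreIntegrand (k := 2 * k + 1) (caloronChernWeil f A Φ) (π ∘ p)
    (hp.dSmooth_comp hπ.smooth_proj)).const_smul ((k : ℝ) + 1)⁻¹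
  refine (congrArg (ContDiff ℝ ∞) (funext fun z => ?_)).mp h
  rw [fibreIntegrand_caloronChernWeil A Φ hp f, smul_smul, inv_mul_cancel₀ (by positivity),
    one_smul]

end StringForm

theorem mainTheorem9 {E G P M : Type*} [NormedAddCommGroup E] [NormedSpace ℝ E]
    [FiniteDimensional ℝ E] [TopologicalSpace G] [ChartedSpace E G] [Group G]
    [LieGroup 𝓘(ℝ, E) ∞ G] [DiffeologicalSpace G] [IsContMDiffCompatible E G]
    [DiffeologicalSpace P] [DiffeologicalSpace M] [MulAction (LoopGroup E G)ᵐᵒᵖ P]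
    {π : P → M} (hπ : IsPrincipalBundle (LoopGroup E G) π)
    (A : LoopConnection hπ) (Φ : HiggsField hπ) (k : ℕ) (f : InvariantPolynomial E G (k + 1)) :
    IsCaloronConnection A Φ (caloronConnection A Φ) ∧
    (caloronChernWeil f A Φ).pullback (caloronProj hπ) (dSmooth_caloronProj hπ) =
      polyCurvature f (curvature G (caloronConnection A Φ)) ∧
    ∃ h : SmoothLoopOfForms (higgsCurvatureForm f.toMultilinear A Φ),
      (stringForm f A Φ).pullback π hπ.smooth_proj = ((k : ℝ) + 1) • loopIntegral _ h := by
  refine ⟨isCaloronConnection_caloronConnection A Φ, caloronChernWeil_pullback A Φ f,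
    smoothLoopOfForms_higgsCurvatureForm A Φ f, ?_⟩
  refine DForm.ext fun p hp x => ?_
  refine (intervalIntegral.integral_congr fun t _ =>
    fibreIntegrand_caloronChernWeil A Φ hp f x t).trans ?_
  exact intervalIntegral.integral_smul _ _
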